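/- Let $\mu$ be an infinite cardinal such that $2^\mu=\mu^+$ and $\mu^{<\mu}=\mu$, where $\mu^{<\mu}=\sup\{\mu^\kappa:\kappa<\mu \text{ a cardinal}\}$. Suppose that there is a set $S\subseteq\{\alpha<\mu^+:\mathrm{cf}\,\alpha<\mu\}$ which is stationary in $\mu^+$ and non-reflecting, i.e. there is no ordinal $\alpha<\mu^+$ of uncountable cofinality such that $S\cap\alpha$ is stationary in $\alpha$. Then there is a $\mu$-complete Souslin tree on $\mu^+$: that is, a partially ordered set $(T,<)$ of cardinality $\mu^+$ in which the set $\{y\in T: y<x\}$ of predecessors of each $x\in T$ is well ordered, such that $T$ has height $\mu^+$ (the least ordinal greater than the order types of all the sets $\{y : y<x\}$, $x\in T$, is $\mu^+$), every chain and every antichain (set of pairwise incomparable elements) of $T$ has cardinality less than $\mu^+$, and every strictly increasing sequence in $T$ of length less than $\mu$ has an upper bound in $T$. -/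

import Mathlib

universe u

/-- `S ∩ α` is stationary in the ordinal `α`, i.e. it meets every closed unbounded subset of `α`. -/
def StationaryIn (S : Set Ordinal.{u}) (α : Ordinal.{u}) : Prop :=
  IsStationary {x : Set.Iio α | (x : Ordinal.{u}) ∈ S}

/-- `S` does not reflect below `δ`: there is no `α < δ` of uncountable cofinality such that
`S ∩ α` is stationary in `α`. -/
def NonReflectingIn (S : Set Ordinal.{u}) (δ : Ordinal.{u}) : Prop :=
  ∀ α < δ, Cardinal.aleph0 < α.cof → ¬ StationaryIn S α

/-- A set-theoretic tree: a partially ordered set in which the predecessors of every element are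
well ordered. -/
class IsOrderTree (T : Type u) [PartialOrder T] : Prop where
  isWellOrder_Iio : ∀ x : T, IsWellOrder (Set.Iio x) (· < ·)

attribute [instance] IsOrderTree.isWellOrder_Iio

namespace IsOrderTree

variable (T : Type u) [PartialOrder T] [IsOrderTree T]

/-- The level of `x` in the tree: the order type of its set of predecessors. -/
noncomputable def level {T : Type u} [PartialOrder T] [IsOrderTree T] (x : T) : Ordinal.{u} :=
  Ordinal.type (fun a b : Set.Iio x => a < b)

/-- The height of the tree: the least ordinal larger than the levels of all elements. -/
noncomputable def height : Ordinal.{u} :=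
  ⨆ x : T, Order.succ (level x)

end IsOrderTree

/-- `T` is a Souslin tree on the cardinal `κ`: a tree with `κ` elements and of height `κ`, in which
all chains (equivalently, all branches) and all antichains have cardinality less than `κ`. -/
structure IsSouslinTree (κ : Cardinal.{u}) (T : Type u) [PartialOrder T] : Prop where
  isOrderTree : IsOrderTree T
  mk_eq : Cardinal.mk T = κ
  height_eq : IsOrderTree.height T = κ.ord
  mk_chain_lt : ∀ C : Set T, IsChain (· ≤ ·) C → Cardinal.mk C < κ
  mk_antichain_lt : ∀ A : Set T, IsAntichain (· ≤ ·) A → Cardinal.mk A < κ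

/-- `T` is `μ`-complete: every strictly increasing sequence of elements of `T` whose length is an
ordinal `β < μ` has an upper bound in `T`. -/
def IsCompleteTree (μ : Cardinal.{u}) (T : Type u) [PartialOrder T] : Prop :=
  ∀ β < μ.ord, ∀ s : Set.Iio β → T, StrictMono s → ∃ b : T, ∀ i, s i ≤ b

open Cardinal Ordinal Set

/-! Nodes of the tree are subsets of ordinals ordered by end-extension. A level whose cofinality is
not `μ` takes every branch through the earlier levels. This makes the tree `μ`-complete, and `μ^{<μ}
= μ` keeps such levels of size at most `μ`. At a level `δ` of cofinality `μ` one branch is kept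
through each earlier node, and these branches must stop every antichain from growing to size `μ⁺`. A
branch built along a short club `c δ` can settle a guessed antichain `G ξ` at every isolated point
`ξ` of `c δ`. The limit stages inside `c δ` have cofinality below `μ`, so the construction cannot
get stuck there.

It therefore suffices to find short clubs `c δ` and guesses `G ξ` such that every set `A` is guessed
at unboundedly many isolated points of some `c δ` (`exists_isHittingSystem`). The cardinal
arithmetic gives diamond on `S` (`exists_diamond`), but the points of `S` have cofinality below `μ`
and must be placed inside clubs of ordinals of cofinality `μ`, as isolated points. Non-reflection
gives clubs `e γ` whose limit points avoid `S` (`NonReflectingIn.exists_thin_club`). Walking down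
along the `e γ` and stopping at points of a set `Z ⊆ S` enlarges each `e δ` to a club in which every
point of `Z` is isolated. If no such system were hitting, `ω` successive counterexamples, all
guessed at once by diamond, would contradict each other.

Given a hitting system, let an antichain be guessed at points `ξ` of `c δ` closed under a suitable
function. Each node on level `δ` has then been settled before some such `ξ`, so the antichain has no
element on a level `≥ δ` (`exists_bound_antichain`). A long chain would yield a long antichain of
nodes splitting off from it (`exists_bound_chain`). -/

/-- `ν` is a limit point of the set of ordinals `X`. -/
def IsLimitPoint (X : Set Ordinal.{u}) (ν : Ordinal.{u}) : Prop :=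
  0 < ν ∧ ∀ η < ν, ∃ x ∈ X, η < x ∧ x < ν

/-- `ξ` is a nonzero ordinal closed under the function `φ`. -/
def ClosedUnder (φ : Ordinal.{u} → Ordinal.{u}) (ξ : Ordinal.{u}) : Prop :=
  0 < ξ ∧ ∀ η < ξ, φ η < ξ

theorem IsLimitPoint.mono {X Y : Set Ordinal.{u}} {ν : Ordinal.{u}} (h : IsLimitPoint X ν)
    (hXY : X ∩ Iio ν ⊆ Y) : IsLimitPoint Y ν :=
  ⟨h.1, fun η hη => let ⟨x, hx, h1, h2⟩ := h.2 η hη; ⟨x, hXY ⟨hx, h2⟩, h1, h2⟩⟩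

/-! ### Cardinal arithmetic and cofinality below `μ⁺` -/

/-- By König's inequality `μ ^ cof μ > μ`, so `cof μ` cannot be smaller than `μ`. -/
theorem isRegular_of_powerlt_eq {μ : Cardinal.{u}} (hμ : ℵ₀ ≤ μ) (hlt : powerlt μ μ = μ) :
    μ.IsRegular := by
  refine ⟨hμ, ?_⟩
  by_contra! h
  exact (lt_power_cof_ord hμ).not_ge ((le_powerlt μ h).trans_eq hlt)

theorem lift_power_le_of_powerlt_eq {μ : Cardinal.{u}} (hlt : powerlt μ μ = μ)
    {c : Cardinal.{u + 1}} (hc : c < lift.{u + 1} μ) :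
    lift.{u + 1} μ ^ c ≤ lift.{u + 1} μ := by
  obtain ⟨d, rfl⟩ := mem_range_lift_of_le hc.le
  rw [← lift_power, Cardinal.lift_le]
  exact (le_powerlt μ (lift_lt.1 hc)).trans_eq hlt

theorem mk_Iio_le_of_lt_succ_ord {μ : Cardinal.{u}} {α : Ordinal.{u}} (h : α < (Order.succ μ).ord) :
    #(Iio α) ≤ lift.{u + 1} μ := by
  rw [Cardinal.mk_Iio_ordinal, Cardinal.lift_le]
  exact Order.lt_succ_iff.1 (lt_ord.1 h)

theorem cof_le_of_lt_succ_ord {μ : Cardinal.{u}} {α : Ordinal.{u}} (h : α < (Order.succ μ).ord) :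
    α.cof ≤ μ :=
  (cof_le_card α).trans (Order.lt_succ_iff.1 (lt_ord.1 h))

theorem exists_bound_of_mk_lt_cof {X : Set Ordinal.{u}} {δ : Ordinal.{u}}
    (hX : #X < lift.{u + 1} δ.cof) (h : ∀ x ∈ X, x < δ) : ∃ β < δ, ∀ x ∈ X, x ≤ β := by
  refine ⟨sSup X, sSup_lt_of_lt_cof (by rwa [← lift_cof]) h, fun x hx => ?_⟩
  exact le_csSup ⟨δ, fun y hy => (h y hy).le⟩ hx

theorem exists_bound_lt_succ_ord {μ : Cardinal.{u}} (hμ : ℵ₀ ≤ μ) {ι : Type (u + 1)}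
    (hι : #ι ≤ lift.{u + 1} μ) (f : ι → Ordinal.{u}) (h : ∀ i, f i < (Order.succ μ).ord) :
    ∃ β < (Order.succ μ).ord, ∀ i, f i ≤ β := by
  obtain ⟨β, hβ, h'⟩ := exists_bound_of_mk_lt_cof (X := range f) (δ := (Order.succ μ).ord)
    (by
      rw [(isRegular_succ hμ).cof_ord, Cardinal.lift_succ, Order.lt_succ_iff]
      exact mk_range_le.trans hι) (by rintro _ ⟨i, rfl⟩; exact h i)
  exact ⟨β, hβ, fun i => h' _ ⟨i, rfl⟩⟩

theorem succ_lt_succ_ord {μ : Cardinal.{u}} (hμ : ℵ₀ ≤ μ) {α : Ordinal.{u}}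
    (h : α < (Order.succ μ).ord) : Order.succ α < (Order.succ μ).ord :=
  (isSuccLimit_ord (hμ.trans (Order.le_succ μ))).succ_lt h

/-- Every ordinal has a cofinal subset whose order type is the cofinality. -/
theorem exists_cofinal_subset (γ : Ordinal.{u}) :
    ∃ a ⊆ Iio γ, (∀ η < γ, ∃ x ∈ a, η ≤ x) ∧ #a ≤ lift.{u + 1} γ.cof ∧
      ∀ η < γ, #(a ∩ Iio η : Set Ordinal.{u}) < lift.{u + 1} γ.cof := by
  obtain ⟨f, hf⟩ := exists_isFundamentalSeq (o := γ) rfl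
  refine ⟨range fun i => (f i : Ordinal), ?_, fun η hη => ?_, ?_, fun η hη => ?_⟩
  · rintro _ ⟨i, rfl⟩; exact (f i).2
  · obtain ⟨_, ⟨i, rfl⟩, hi⟩ := hf.isCofinal_range ⟨η, hη⟩
    exact ⟨_, ⟨i, rfl⟩, hi⟩
  · refine mk_range_le.trans ?_
    rw [Cardinal.mk_Iio_ordinal, card_ord]
  · obtain ⟨_, ⟨i, rfl⟩, hi⟩ := hf.isCofinal_range ⟨η, hη⟩
    have hsub : (range (fun i => (f i : Ordinal)) ∩ Iio η) ⊆
        range (fun j : Iio i.1 => (f ⟨j.1, lt_trans (show j.1 < i.1 from j.2) i.2⟩ : Ordinal)) := by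
      rintro _ ⟨⟨j, rfl⟩, hj⟩
      have : f j < f i := lt_of_lt_of_le (show (f j).1 < η from hj) hi
      exact ⟨⟨j.1, hf.strictMono.lt_iff_lt.1 this⟩, rfl⟩
    refine (mk_le_mk_of_subset hsub).trans_lt (mk_range_le.trans_lt ?_)
    rw [Cardinal.mk_Iio_ordinal, Cardinal.lift_lt]
    exact lt_ord.1 i.2

theorem IsLimitPoint.cof_le_mk {X : Set Ordinal.{u}} {ν : Ordinal.{u}} (h : IsLimitPoint X ν) :
    lift.{u + 1} ν.cof ≤ #(X ∩ Iio ν : Set Ordinal.{u}) := by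
  by_contra! hlt
  obtain ⟨β, hβ, hb⟩ := exists_bound_of_mk_lt_cof hlt (fun x hx => hx.2)
  obtain ⟨x, hx, h1, h2⟩ := h.2 β hβ
  exact (hb x ⟨hx, h2⟩).not_gt h1

theorem IsLimitPoint.isSuccLimit {X : Set Ordinal.{u}} {ν : Ordinal.{u}} (h : IsLimitPoint X ν) :
    Order.IsSuccLimit ν := by
  rw [isSuccLimit_iff, Order.isSuccPrelimit_iff_succ_lt]
  refine ⟨h.1.ne', fun a ha => ?_⟩
  obtain ⟨x, -, h1, h2⟩ := h.2 a ha
  exact (Order.succ_le_of_lt h1).trans_lt h2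

/-! ### Closure points and diamond on `S` -/

/-- A set which is stationary in `(succ μ).ord` meets the set of closure points of every function
on this ordinal. -/
theorem StationaryIn.exists_closedUnder {μ : Cardinal.{u}} (hμ : ℵ₀ ≤ μ) {S : Set Ordinal.{u}}
    (hS : StationaryIn S (Order.succ μ).ord) {φ : Ordinal.{u} → Ordinal.{u}}
    (hφ : ∀ η < (Order.succ μ).ord, φ η < (Order.succ μ).ord) :
    ∃ ξ ∈ S, ξ < (Order.succ μ).ord ∧ ClosedUnder φ ξ := by
  set Λ := (Order.succ μ).ord with hΛ
  have key : IsClub {x : Iio Λ | ClosedUnder φ x} := by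
    constructor
    · intro t ht hne _ a ha
      refine ⟨?_, fun η hη => ?_⟩
      · obtain ⟨x, hx⟩ := hne
        exact (ht hx).1.trans_le (ha.1 hx)
      · have : ¬ (⟨η, hη.trans a.2⟩ : Iio Λ) ∈ upperBounds t := fun h' =>
          (ha.2 h').not_gt hη
        simp only [upperBounds, Set.mem_ofPred_eq, not_forall, not_le] at this
        obtain ⟨x, hx, hlt⟩ := this
        exact ((ht hx).2 η hlt).trans_le (ha.1 hx)
    · intro a
      have hbd : ∀ β < Λ, ∃ β' < Λ, β < β' ∧ ∀ η ≤ β, φ η < β' := by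
        intro β hβ
        obtain ⟨b, hb, h⟩ := exists_bound_lt_succ_ord hμ (ι := Iio (Order.succ β))
          (mk_Iio_le_of_lt_succ_ord (succ_lt_succ_ord hμ hβ)) (fun i => φ i)
          (fun i => hφ _ ((Order.lt_succ_iff.1 i.2).trans_lt hβ))
        refine ⟨Order.succ (max b β), succ_lt_succ_ord hμ (max_lt hb hβ), ?_, fun η hη => ?_⟩
        · exact Order.lt_succ_iff.2 (le_max_right _ _)
        · exact Order.lt_succ_iff.2 ((h ⟨η, Order.lt_succ_iff.2 hη⟩).trans (le_max_left _ _))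
      -- `g β` exceeds `β` and all values of `φ` on `[0, β]`, so the supremum of the iterates of `g`
      -- from `a` is closed under `φ`.
      choose! g hgΛ hg1 hg2 using hbd
      have hit : ∀ n : ℕ, g^[n] a.1 < Λ := fun n => by
        induction n with
        | zero => exact a.2
        | succ n ih => rw [Function.iterate_succ_apply']; exact hgΛ _ ih
      obtain ⟨β, hβ, hle⟩ := exists_bound_lt_succ_ord hμ (ι := ULift.{u + 1} ℕ)
        (by simpa using hμ) (fun n => g^[n.down] a.1) (fun n => hit n.down)
      have hbdd : BddAbove (range fun n : ℕ => g^[n] a.1) := ⟨β, by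
        rintro _ ⟨n, rfl⟩; exact hle ⟨n⟩⟩
      have hlt : ∀ n : ℕ, g^[n] a.1 < ⨆ n : ℕ, g^[n] a.1 := fun n => by
        refine lt_of_lt_of_le ?_ (le_ciSup hbdd (n + 1))
        rw [Function.iterate_succ_apply']
        exact hg1 _ (hit n)
      refine ⟨⟨⨆ n : ℕ, g^[n] a.1, (ciSup_le fun n => hle ⟨n⟩).trans_lt hβ⟩, ⟨?_, ?_⟩, ?_⟩
      · exact (zero_le).trans_lt (hlt 0)
      · intro η hη
        obtain ⟨n, hn⟩ := exists_lt_of_lt_ciSup hη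
        refine (hg2 _ (hit n) η hn.le).trans ?_
        have := hlt (n + 1)
        rwa [Function.iterate_succ_apply'] at this
      · exact (hlt 0).le
  obtain ⟨x, hx, hx'⟩ := hS key
  exact ⟨x, hx, x.2, hx'⟩

theorem exists_surjective_of_mk_le {α β : Type*} [Nonempty α] (h : lift.{u_2} #α ≤ lift.{u_1} #β) :
    ∃ f : β → α, Function.Surjective f := by
  obtain ⟨e⟩ := lift_mk_le'.1 h
  exact ⟨Function.invFun e, Function.invFun_surjective e.injective⟩

/-- This is `(μ⁺)^μ = (2^μ)^μ = 2^μ = μ⁺`. -/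
theorem mk_pi_le_lift_succ {μ : Cardinal.{u}} (hμ : ℵ₀ ≤ μ) (h2 : (2 : Cardinal.{u}) ^ μ = Order.succ μ)
    {ι V : Type (u + 1)} (hι : #ι ≤ lift.{u + 1} μ) (hV : #V ≤ lift.{u + 1} (Order.succ μ)) :
    #(ι → V) ≤ lift.{u + 1} (Order.succ μ) := by
  rw [← power_def]
  have h0 : lift.{u + 1} (Order.succ μ) ≠ 0 := by
    rw [Ne, Cardinal.lift_eq_zero]; exact (Order.bot_lt_succ μ).ne'
  calc #V ^ #ι ≤ lift.{u + 1} (Order.succ μ) ^ lift.{u + 1} μ :=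
        (power_le_power_right hV).trans (power_le_power_left h0 hι)
    _ = lift.{u + 1} (Order.succ μ) := by
        rw [← lift_power, ← h2, ← power_mul, mul_eq_self hμ]

/-- Under `2 ^ μ = succ μ`, all the restrictions of functions to bounded initial segments of
`(succ μ).ord` can be enumerated by `(succ μ).ord`. -/
theorem exists_enum_bounded_functions {μ : Cardinal.{u}} (hμ : ℵ₀ ≤ μ)
    (h2 : (2 : Cardinal.{u}) ^ μ = Order.succ μ) (V : Type (u + 1)) [Nonempty V]
    (hV : #V ≤ lift.{u + 1} (Order.succ μ)) :
    ∃ B : Ordinal.{u} → Ordinal.{u} → V, ∀ f : Ordinal.{u} → V, ∀ β < (Order.succ μ).ord,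
      ∃ i < (Order.succ μ).ord, ∀ η ≤ β, B i η = f η := by
  classical
  set Λ := (Order.succ μ).ord with hΛ
  let F := Σ β : Iio Λ, (Iio (Order.succ β.1) → V)
  have hI : #(Iio Λ) = lift.{u + 1} (Order.succ μ) := by
    rw [Cardinal.mk_Iio_ordinal, card_ord]
  have hF : #F ≤ #(Iio Λ) := by
    rw [mk_sigma]
    refine (sum_le_sum _ (fun _ => lift.{u + 1} (Order.succ μ)) fun β => ?_).trans ?_
    · exact mk_pi_le_lift_succ hμ h2
        (mk_Iio_le_of_lt_succ_ord (succ_lt_succ_ord hμ β.2)) hV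
    · rw [sum_const', hI, mul_eq_self]
      rw [aleph0_le_lift]
      exact hμ.trans (Order.le_succ μ)
  have h0 : 0 < Λ := (isSuccLimit_ord (hμ.trans (Order.le_succ μ))).bot_lt
  have : Nonempty F := ⟨⟨⟨0, h0⟩, fun _ => Classical.arbitrary V⟩⟩
  obtain ⟨s, hs⟩ := exists_surjective_of_mk_le (α := F) (β := Iio Λ) (by simpa using hF)
  refine ⟨fun i η => if hi : i < Λ then
    if hη : η < Order.succ (s ⟨i, hi⟩).1.1 then (s ⟨i, hi⟩).2 ⟨η, hη⟩ else Classical.arbitrary V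
    else Classical.arbitrary V, fun f β hβ => ?_⟩
  obtain ⟨⟨i, hi⟩, h⟩ := hs ⟨⟨β, hβ⟩, fun η => f η.1⟩
  refine ⟨i, hi, fun η hη => ?_⟩
  simp only [dif_pos (show i < Λ from hi)]
  rw [h]
  exact dif_pos (Order.lt_succ_iff.2 hη)

/-- Gregory's list version of diamond: on a stationary set of ordinals of cofinality less than `μ`,
every function is guessed by one of `μ` many candidates. -/
theorem exists_diamond_list {μ : Cardinal.{u}} (hμ : ℵ₀ ≤ μ)
    (h2 : (2 : Cardinal.{u}) ^ μ = Order.succ μ) (hlt : powerlt μ μ = μ) {S : Set Ordinal.{u}}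
    (hcof : ∀ α ∈ S, α.cof < μ) (hS : StationaryIn S (Order.succ μ).ord)
    (V : Type (u + 1)) [Nonempty V] (hV : #V ≤ lift.{u + 1} (Order.succ μ)) :
    ∃ g : Ordinal.{u} → Iio μ.ord → Ordinal.{u} → V, ∀ (f : Ordinal.{u} → V)
      (φ : Ordinal.{u} → Ordinal.{u}),
      (∀ η < (Order.succ μ).ord, φ η < (Order.succ μ).ord) →
      ∃ ξ ∈ S, ξ < (Order.succ μ).ord ∧ ClosedUnder φ ξ ∧ ∃ ε, ∀ η < ξ, f η = g ξ ε η := by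
  classical
  obtain ⟨B, hB⟩ := exists_enum_bounded_functions hμ h2 V hV
  set Λ := (Order.succ μ).ord with hΛ
  choose a ha hac hacard _ using exists_cofinal_subset.{u}
  have hI : #(Iio μ.ord) = lift.{u + 1} μ := by rw [Cardinal.mk_Iio_ordinal, card_ord]
  -- As `a ξ` has size at most `cof ξ < μ` and `ξ` has size at most `μ`, `μ^{<μ} = μ` leaves only
  -- `μ` functions from `a ξ` to `ξ`; `h` lists them.
  have key : ∀ ξ ∈ S, ξ < Λ → 0 < ξ → ∃ h : Iio μ.ord → a ξ → Ordinal.{u},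
      ∀ p : a ξ → Ordinal.{u}, (∀ y, p y < ξ) → ∃ ε, h ε = p := by
    intro ξ hξ hξΛ h0
    have : Nonempty (a ξ → Iio ξ) := ⟨fun _ => ⟨0, h0⟩⟩
    obtain ⟨s, hs⟩ := exists_surjective_of_mk_le (α := a ξ → Iio ξ) (β := Iio μ.ord) (by
      rw [hI, ← power_def]
      simp only [Cardinal.lift_id]
      refine le_trans (power_le_power_right (mk_Iio_le_of_lt_succ_ord hξΛ)) ?_
      exact lift_power_le_of_powerlt_eq hlt
        ((hacard ξ).trans_lt (Cardinal.lift_lt.2 (hcof ξ hξ))))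
    refine ⟨fun ε y => s ε y, fun p hp => ?_⟩
    obtain ⟨ε, hε⟩ := hs fun y => ⟨p y, hp y⟩
    exact ⟨ε, funext fun y => by simp only [hε]⟩
  choose! h hh using key
  have hx : ∀ ξ η : Ordinal.{u}, ∃ x : Ordinal.{u}, η < ξ → x ∈ a ξ ∧ η ≤ x := fun ξ η => by
    by_cases hη : η < ξ
    · obtain ⟨x, hx⟩ := hac ξ η hη
      exact ⟨x, fun _ => hx⟩
    · exact ⟨0, fun h => absurd h hη⟩
  choose x hx using hx
  refine ⟨fun ξ ε η => if hxa : x ξ η ∈ a ξ then B (h ξ ε ⟨x ξ η, hxa⟩) η else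
    Classical.arbitrary V, fun f φ hφ => ?_⟩
  -- `idx y` is an index of `f` restricted to `[0, y]`. If `ξ` is closed under `idx`, the function
  -- `idx` on the cofinal set `a ξ` takes values below `ξ`, so it appears in the list, and the
  -- pieces it names glue to `f` below `ξ`.
  choose! idx hidx hidx' using hB f
  obtain ⟨ξ, hξS, hξΛ, hξ0, hξ⟩ := hS.exists_closedUnder hμ (φ := fun η => max (φ η) (idx η))
    (fun η hη => max_lt (hφ η hη) (hidx η hη))
  obtain ⟨ε, hε⟩ := hh ξ hξS hξΛ hξ0 (fun y => idx y) (fun y => (le_max_right _ _).trans_lt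
    (hξ y (ha ξ y.2)))
  refine ⟨ξ, hξS, hξΛ, ⟨hξ0, fun η hη => (le_max_left _ _).trans_lt (hξ η hη)⟩, ε,
    fun η hη => ?_⟩
  obtain ⟨h1, h2⟩ := hx ξ η hη
  simp only [dif_pos h1, hε]
  exact (hidx' _ ((ha ξ h1).trans hξΛ) η h2).symm

/-- The diamond principle on a stationary set of ordinals of cofinality less than `μ`. -/
theorem exists_diamond {μ : Cardinal.{u}} (hμ : ℵ₀ ≤ μ)
    (h2 : (2 : Cardinal.{u}) ^ μ = Order.succ μ) (hlt : powerlt μ μ = μ) {S : Set Ordinal.{u}}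
    (hcof : ∀ α ∈ S, α.cof < μ) (hS : StationaryIn S (Order.succ μ).ord)
    (V : Type (u + 1)) [Nonempty V] (hV : #V ≤ lift.{u + 1} (Order.succ μ)) :
    ∃ g : Ordinal.{u} → Ordinal.{u} → V, ∀ (f : Ordinal.{u} → V) (φ : Ordinal.{u} → Ordinal.{u}),
      (∀ η < (Order.succ μ).ord, φ η < (Order.succ μ).ord) →
      ∃ ξ ∈ S, ξ < (Order.succ μ).ord ∧ ClosedUnder φ ξ ∧ ∀ η < ξ, f η = g ξ η := by
  have hI : #(Iio μ.ord) ≤ lift.{u + 1} μ := by rw [Cardinal.mk_Iio_ordinal, card_ord]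
  -- Diagonalization: guess `μ`-sequences of functions, and suppose that for every `ε` the `ε`-th
  -- coordinate of the `ε`-th candidate is not a diamond sequence, as witnessed by `f ε` and `φ ε`.
  -- Guessing all the `f ε` simultaneously gives an `ε` at which the witness fails.
  obtain ⟨g, hg⟩ := exists_diamond_list hμ h2 hlt hcof hS (Iio μ.ord → V)
    (mk_pi_le_lift_succ hμ h2 hI hV)
  by_contra! H
  choose f φ hφ hf using fun ε => H fun ξ η => g ξ ε η ε
  have hbd : ∀ η : Ordinal.{u}, ∃ β, η < (Order.succ μ).ord → β < (Order.succ μ).ord ∧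
      ∀ ε, φ ε η ≤ β := fun η => by
    by_cases hη : η < (Order.succ μ).ord
    · obtain ⟨β, h1, h2⟩ := exists_bound_lt_succ_ord hμ hI (fun ε => φ ε η) (fun ε => hφ ε η hη)
      exact ⟨β, fun _ => ⟨h1, h2⟩⟩
    · exact ⟨0, fun h => absurd h hη⟩
  choose ψ hψ using hbd
  obtain ⟨ξ, hξS, hξΛ, ⟨hξ0, hξ⟩, ε, hε⟩ := hg (fun η ε => f ε η) ψ (fun η hη => (hψ η hη).1)
  obtain ⟨η, hη, hne⟩ := hf ε ξ hξS hξΛ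
    ⟨hξ0, fun η hη => ((hψ η (hη.trans hξΛ)).2 ε).trans_lt (hξ η hη)⟩
  exact hne (congrFun (hε η hη) ε)

/-! ### Short clubs avoiding `S` -/

/-- Send each limit point to the least element of `X'` above or equal to it. This map is strictly
increasing, since a point of `X` lies strictly between any two limit points. -/
theorem mk_limitPoints_le {X X' P : Set Ordinal.{u}}
    (hdown : ∀ x ∈ X, ∀ x' ∈ X', x ≤ x' → x ∈ X') (hP : ∀ ν ∈ P, IsLimitPoint X ν)
    (hPX : ∀ ν ∈ P, ∃ x ∈ X', ν ≤ x) : #P ≤ #X' := by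
  have hmem : ∀ ν ∈ P, sInf {x ∈ X' | ν ≤ x} ∈ {x ∈ X' | ν ≤ x} := fun ν hν =>
    csInf_mem (hPX ν hν)
  refine mk_le_of_injective (f := fun ν : P => (⟨_, (hmem ν.1 ν.2).1⟩ : X')) ?_
  refine StrictMono.injective fun ν ν' hlt => ?_
  obtain ⟨x, hx, h1, h2⟩ := (hP _ ν'.2).2 _ hlt
  obtain ⟨h3, h4⟩ := hmem _ ν'.2
  have : x ∈ X' := hdown x hx _ h3 (h2.le.trans h4)
  have h5 : sInf {x ∈ X' | ν.1 ≤ x} ≤ x := csInf_le' ⟨this, h1.le⟩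
  exact h5.trans_lt (h2.trans_le h4)

/-- Any club of `γ` contains a closed cofinal set whose order type is the cofinality of `γ`,
provided that the cofinality is uncountable. -/
theorem exists_thin_club {γ : Ordinal.{u}} (hγ : ℵ₀ < γ.cof) {C : Set Ordinal.{u}}
    (hC : C ⊆ Iio γ) (hcof : ∀ η < γ, ∃ x ∈ C, η ≤ x)
    (hcl : ∀ ν < γ, IsLimitPoint C ν → ν ∈ C) :
    ∃ e ⊆ C, (∀ η < γ, ∃ x ∈ e, η ≤ x) ∧ (∀ ν < γ, IsLimitPoint e ν → ν ∈ e) ∧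
      #e ≤ lift.{u + 1} γ.cof ∧ ∀ η < γ, #(e ∩ Iio η : Set Ordinal.{u}) < lift.{u + 1} γ.cof := by
  obtain ⟨a, haγ, hac, ha1, ha2⟩ := exists_cofinal_subset γ
  have hlim : Order.IsSuccLimit γ := one_lt_cof_iff.1 (one_lt_aleph0.trans hγ)
  choose! m hmC hm using hcof
  have hinf : ℵ₀ ≤ lift.{u + 1} γ.cof := aleph0_le_lift.2 hγ.le
  set X := m '' a with hX
  have hXC : X ⊆ C := by
    rintro _ ⟨x, hx, rfl⟩; exact hmC x (haγ hx)
  have hX1 : #X ≤ lift.{u + 1} γ.cof := mk_image_le.trans ha1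
  have hX2 : ∀ η < γ, #(X ∩ Iio η : Set Ordinal.{u}) < lift.{u + 1} γ.cof := fun η hη => by
    have : X ∩ Iio η ⊆ m '' (a ∩ Iio η) := by
      rintro _ ⟨⟨x, hx, rfl⟩, hlt⟩
      exact ⟨x, ⟨hx, (hm x (haγ hx)).trans_lt hlt⟩, rfl⟩
    exact ((mk_le_mk_of_subset this).trans mk_image_le).trans_lt (ha2 η hη)
  have hXcof : ∀ η < γ, ∃ x ∈ X, η ≤ x := fun η hη => by
    obtain ⟨x, hx, h⟩ := hac η hη
    exact ⟨_, ⟨x, hx, rfl⟩, h.trans (hm x (haγ hx))⟩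
  -- `X` is the thin cofinal set `a` pushed into `C`; closing it under limits stays in `C` and, by
  -- `mk_limitPoints_le`, preserves the size bounds.
  refine ⟨X ∪ {ν | ν < γ ∧ IsLimitPoint X ν}, ?_, fun η hη => ?_, fun ν hν h => ?_, ?_,
    fun η hη => ?_⟩
  · rintro ν (h | ⟨h1, h2⟩)
    · exact hXC h
    · exact hcl ν h1 (h2.mono (inter_subset_left.trans hXC))
  · obtain ⟨x, hx, h⟩ := hXcof η hη
    exact ⟨x, Or.inl hx, h⟩
  · refine Or.inr ⟨hν, h.1, fun η hη => ?_⟩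
    obtain ⟨x, hx | hx, h1, h2⟩ := h.2 η hη
    · exact ⟨x, hx, h1, h2⟩
    · obtain ⟨y, hy, h3, h4⟩ := hx.2.2 η h1
      exact ⟨y, hy, h3, h4.trans h2⟩
  · refine (mk_union_le _ _).trans ?_
    refine (add_le_add hX1 ((mk_limitPoints_le (X := X) (X' := X)
      (fun x hx _ _ _ => hx) (fun ν h => h.2) fun ν h => hXcof ν h.1).trans hX1)).trans ?_
    rw [add_eq_self hinf]
  · rw [union_inter_distrib_right]
    refine (mk_union_le _ _).trans_lt (add_lt_of_lt hinf (hX2 η hη) ?_)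
    obtain ⟨y, hy, hηy⟩ := hXcof η hη
    refine (mk_limitPoints_le (X := X) (X' := X ∩ Iio (Order.succ y))
      (fun x hx x' hx' hle => ⟨hx, hle.trans_lt hx'.2⟩) (fun ν h => h.1.2)
      (fun ν h => ⟨y, ⟨hy, Order.lt_succ y⟩, (show ν < η from h.2).le.trans hηy⟩)).trans_lt ?_
    exact hX2 _ (hlim.succ_lt (hC (hXC hy)))

/-- If `S` does not reflect, every `γ` below has a closed cofinal subset of order type at most
`γ.cof` none of whose limit points below `γ` is in `S`. -/
theorem NonReflectingIn.exists_thin_club {S : Set Ordinal.{u}} {Λ γ : Ordinal.{u}}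
    (hS : NonReflectingIn S Λ) (hγ : γ < Λ) :
    ∃ e ⊆ Iio γ, (∀ η < γ, ∃ x ∈ e, η ≤ x) ∧ (∀ ν < γ, IsLimitPoint e ν → ν ∈ e ∧ ν ∉ S) ∧
      #e ≤ lift.{u + 1} γ.cof ∧ ∀ η < γ, #(e ∩ Iio η : Set Ordinal.{u}) < lift.{u + 1} γ.cof := by
  rcases le_or_gt γ.cof ℵ₀ with h | h
  -- In countable cofinality the proper initial segments of `a` are finite, so `a` has no limit
  -- points below `γ`.
  · obtain ⟨a, haγ, hac, ha1, ha2⟩ := exists_cofinal_subset γ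
    refine ⟨a, haγ, hac, fun ν hν hlim => ?_, ha1, ha2⟩
    have h1 := hlim.cof_le_mk.trans_lt (ha2 ν hν)
    rw [Cardinal.lift_lt] at h1
    have h2 : ℵ₀ ≤ ν.cof := aleph0_le_cof_iff.2 (one_lt_cof_iff.2 hlim.isSuccLimit)
    exact absurd (h1.trans_le h) h2.not_gt
  · obtain ⟨C, hC, hdisj⟩ := not_isStationary_iff.1 (hS γ hγ h)
    obtain ⟨e, he, h1, h2, h3, h4⟩ := _root_.exists_thin_club h (C := Subtype.val '' C)
      (by rintro _ ⟨x, -, rfl⟩; exact x.2)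
      (fun η hη => by
        obtain ⟨x, hx, hle⟩ := hC.isCofinal ⟨η, hη⟩
        exact ⟨x, ⟨x, hx, rfl⟩, hle⟩)
      (fun ν hν hlim => by
        refine ⟨⟨ν, hν⟩, ?_, rfl⟩
        refine hC.isLUB_mem (t := {x ∈ C | x.1 < ν}) (fun x hx => hx.1) ?_ ⟨?_, fun b hb => ?_⟩
        · obtain ⟨_, ⟨x, hx, rfl⟩, -, hlt⟩ := hlim.2 0 hlim.1
          exact ⟨x, hx, hlt⟩
        · exact fun x hx => hx.2.le
        · by_contra! hlt
          obtain ⟨_, ⟨x, hx, rfl⟩, h1, h2⟩ := hlim.2 b.1 hlt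
          exact (hb (show x ∈ {x ∈ C | x.1 < ν} from ⟨hx, h2⟩)).not_gt h1)
    refine ⟨e, fun x hx => ?_, h1, fun ν hν hlim => ⟨h2 ν hν hlim, fun hνS => ?_⟩, h3, h4⟩
    · obtain ⟨y, -, rfl⟩ := he hx; exact y.2
    · obtain ⟨y, hy, rfl⟩ := he (h2 ν hν hlim)
      exact disjoint_left.1 hdisj hνS hy

/-! ### Walks along the club system -/

/-- `WalkReach μ e Z b ν γ`: the walk along `e` from `γ` down to `ν` never passes through an element
of `Z`, and whenever it passes through some `γ'` of cofinality `μ`, then `ν ≤ b γ'`. -/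
inductive WalkReach (μ : Cardinal.{u}) (e : Ordinal.{u} → Set Ordinal.{u}) (Z : Set Ordinal.{u})
    (b : Ordinal.{u} → Ordinal.{u}) (ν : Ordinal.{u}) : Ordinal.{u} → Prop
  | mem {γ : Ordinal.{u}} : ν ∈ e γ → WalkReach μ e Z b ν γ
  | step {γ γ' : Ordinal.{u}} : γ' ∈ e γ → ν < γ' → (∀ x ∈ e γ, ν ≤ x → γ' ≤ x) → γ' ∉ Z →
      (γ'.cof = μ → ν ≤ b γ') → WalkReach μ e Z b ν γ' → WalkReach μ e Z b ν γ

/-- The set of ordinals below `γ` that are reached by walks from `γ`. -/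
def walkSet (μ : Cardinal.{u}) (e : Ordinal.{u} → Set Ordinal.{u}) (Z : Set Ordinal.{u})
    (b : Ordinal.{u} → Ordinal.{u}) (γ : Ordinal.{u}) : Set Ordinal.{u} :=
  {ν | ν < γ ∧ WalkReach μ e Z b ν γ}

/-- `e` assigns to the ordinals below `(succ μ).ord` short closed cofinal subsets with no limit
points in `S`. -/
structure IsClubSystem (μ : Cardinal.{u}) (S : Set Ordinal.{u})
    (e : Ordinal.{u} → Set Ordinal.{u}) : Prop where
  subset : ∀ γ < (Order.succ μ).ord, e γ ⊆ Iio γ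
  cofinal : ∀ γ < (Order.succ μ).ord, ∀ η < γ, ∃ x ∈ e γ, η ≤ x
  closed : ∀ γ < (Order.succ μ).ord, ∀ ν < γ, IsLimitPoint (e γ) ν → ν ∈ e γ ∧ ν ∉ S
  mk_le : ∀ γ < (Order.succ μ).ord, #(e γ) ≤ lift.{u + 1} γ.cof
  mk_lt : ∀ γ < (Order.succ μ).ord, ∀ η < γ,
    #(e γ ∩ Iio η : Set Ordinal.{u}) < lift.{u + 1} γ.cof

section Walk

variable {μ : Cardinal.{u}} {S Z : Set Ordinal.{u}} {e : Ordinal.{u} → Set Ordinal.{u}}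
  {b : Ordinal.{u} → Ordinal.{u}}

theorem IsClubSystem.exists_min (he : IsClubSystem μ S e) {γ η : Ordinal.{u}}
    (hγ : γ < (Order.succ μ).ord) (hη : η < γ) :
    ∃ γ' ∈ e γ, η ≤ γ' ∧ ∀ x ∈ e γ, η ≤ x → γ' ≤ x := by
  have h : {x | x ∈ e γ ∧ η ≤ x}.Nonempty := he.cofinal γ hγ η hη
  exact ⟨sInf {x | x ∈ e γ ∧ η ≤ x}, (csInf_mem h).1, (csInf_mem h).2,
    fun x hx hle => csInf_le' ⟨hx, hle⟩⟩

theorem IsClubSystem.subset_walkSet (he : IsClubSystem μ S e) {γ : Ordinal.{u}}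
    (hγ : γ < (Order.succ μ).ord) : e γ ⊆ walkSet μ e Z b γ :=
  fun _ hν => ⟨he.subset γ hγ hν, .mem hν⟩

/-- Induction on `γ`: a walk either ends in `e γ` or continues from some `γ' ∈ e γ`. If `cof γ' =
μ`, the cut-off `b γ'` leaves only a bounded part of the walk set of `γ'`. Thus fewer than `μ`
pieces of size less than `μ` are united, and `μ` is regular. -/
theorem IsClubSystem.mk_walkSet_lt (hμ : μ.IsRegular) (he : IsClubSystem μ S e)
    (hb : ∀ γ < (Order.succ μ).ord, γ.cof = μ → b γ < γ) (γ : Ordinal.{u})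
    (hγ : γ < (Order.succ μ).ord) :
    (γ.cof ≠ μ → #(walkSet μ e Z b γ) < lift.{u + 1} μ) ∧
      ∀ η < γ, #(walkSet μ e Z b γ ∩ Iio η : Set Ordinal.{u}) < lift.{u + 1} μ := by
  have hreg : (lift.{u + 1} μ).IsRegular := hμ.lift
  induction γ using WellFoundedLT.induction with
  | ind γ ih =>
  let A : Ordinal.{u} → Set Ordinal.{u} := fun γ' =>
    {ν | ν ∈ walkSet μ e Z b γ' ∧ (γ'.cof = μ → ν ≤ b γ')}
  have hA : ∀ γ' ∈ e γ, #(A γ') < lift.{u + 1} μ := fun γ' hγ' => by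
    have hlt := he.subset γ hγ hγ'
    obtain ⟨h1, h2⟩ := ih γ' hlt (hlt.trans hγ)
    by_cases hc : γ'.cof = μ
    · have hlim : Order.IsSuccLimit γ' := by
        rw [← one_lt_cof_iff, hc]; exact one_lt_aleph0.trans_le hμ.aleph0_le
      refine (mk_le_mk_of_subset ?_).trans_lt
        (h2 _ (hlim.succ_lt (hb γ' (hlt.trans hγ) hc)))
      exact fun ν hν => ⟨hν.1, Order.lt_succ_iff.2 (hν.2 hc)⟩
    · exact (mk_le_mk_of_subset fun ν hν => hν.1).trans_lt (h1 hc)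
  have hY : ∀ Y ⊆ e γ, #Y < lift.{u + 1} μ →
      #(Y ∪ ⋃ γ' ∈ Y, A γ' : Set Ordinal.{u}) < lift.{u + 1} μ := fun Y hYe hY => by
    refine (mk_union_le _ _).trans_lt (add_lt_of_lt hreg.aleph0_le hY ?_)
    exact (card_biUnion_lt_iff_forall_of_isRegular (t := fun γ' _ => A γ') hreg hY).2
      fun γ' hγ' => hA γ' (hYe hγ')
  constructor
  · intro hc
    have hlt : #(e γ) < lift.{u + 1} μ := (he.mk_le γ hγ).trans_lt
      (Cardinal.lift_lt.2 ((cof_le_of_lt_succ_ord hγ).lt_of_ne hc))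
    refine (mk_le_mk_of_subset ?_).trans_lt (hY _ subset_rfl hlt)
    rintro ν ⟨-, hν | ⟨h1, h2, -, -, h4, h5⟩⟩
    · exact Or.inl hν
    · exact Or.inr (mem_iUnion₂.2 ⟨_, h1, ⟨h2, h5⟩, h4⟩)
  · intro η hη
    obtain ⟨x, hx, hηx⟩ := he.cofinal γ hγ η hη
    have hlt : #(e γ ∩ Iic x : Set Ordinal.{u}) < lift.{u + 1} μ := by
      have hsub : e γ ∩ Iic x ⊆ insert x (e γ ∩ Iio x) := fun y hy =>
        (eq_or_lt_of_le hy.2).imp id fun h => ⟨hy.1, h⟩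
      refine (mk_le_mk_of_subset hsub).trans_lt ?_
      refine (mk_insert_le).trans_lt (add_lt_of_lt hreg.aleph0_le ?_
        (one_lt_aleph0.trans_le hreg.aleph0_le))
      exact (he.mk_lt γ hγ x (he.subset γ hγ hx)).trans_le
        (Cardinal.lift_le.2 (cof_le_of_lt_succ_ord hγ))
    refine (mk_le_mk_of_subset ?_).trans_lt (hY _ inter_subset_left hlt)
    rintro ν ⟨⟨-, hν | ⟨h1, h2, h3, -, h4, h5⟩⟩, hνη⟩
    · exact Or.inl ⟨hν, (lt_of_lt_of_le hνη hηx).le⟩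
    · exact Or.inr (mem_iUnion₂.2 ⟨_, ⟨h1, h3 x hx (lt_of_lt_of_le hνη hηx).le⟩, ⟨h2, h5⟩, h4⟩)

/-- A limit point of `e γ` is outside `S`, hence outside `Z`. If `ν` is not one, all walks from `γ`
to points just below `ν` share the first step `γ' = min (e γ \ ν)`, which is outside `Z` because
they pass through it. Either `γ' = ν`, or the induction hypothesis applies to `γ'`. -/
theorem IsClubSystem.walkSet_closed (he : IsClubSystem μ S e) (hZ : Z ⊆ S) (γ : Ordinal.{u})
    (hγ : γ < (Order.succ μ).ord) (ν : Ordinal.{u}) (hν : ν < γ)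
    (h : IsLimitPoint (walkSet μ e Z b γ) ν) : ν ∈ walkSet μ e Z b γ ∧ ν ∉ Z := by
  induction γ using WellFoundedLT.induction with
  | ind γ ih =>
  by_cases hlim : IsLimitPoint (e γ) ν
  · obtain ⟨h1, h2⟩ := he.closed γ hγ ν hν hlim
    exact ⟨he.subset_walkSet hγ h1, fun h => h2 (hZ h)⟩
  obtain ⟨η, hη, hgap⟩ : ∃ η < ν, ∀ x ∈ e γ, η < x → ν ≤ x := by
    by_contra! hcon
    exact hlim ⟨h.1, fun η hη => let ⟨x, h1, h2, h3⟩ := hcon η hη; ⟨x, h1, h2, h3⟩⟩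
  obtain ⟨γ', hγ', hle, hmin⟩ := he.exists_min hγ hν
  have key : ∀ x ∈ walkSet μ e Z b γ, η < x → x < ν →
      γ' ∉ Z ∧ (γ'.cof = μ → x ≤ b γ') ∧ x ∈ walkSet μ e Z b γ' := by
    rintro x ⟨hxγ, hx | @⟨_, γ'', h1, h2, h3, h4, h5, h6⟩⟩ hηx hxν
    · exact absurd (hgap x hx hηx) hxν.not_ge
    · obtain rfl : γ'' = γ' := le_antisymm (h3 _ hγ' (hxν.le.trans hle))
        (hmin _ h1 (hgap _ h1 (hηx.trans h2)))
      exact ⟨h4, h5, h2, h6⟩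
  obtain ⟨x₀, hx₀, h1, h2⟩ := h.2 η hη
  obtain ⟨hγ'Z, -, -⟩ := key x₀ hx₀ h1 h2
  rcases hle.eq_or_lt with rfl | hlt
  · exact ⟨he.subset_walkSet hγ hγ', hγ'Z⟩
  · have hlim' : IsLimitPoint (walkSet μ e Z b γ') ν := ⟨h.1, fun ζ hζ => by
      obtain ⟨x, hx, h3, h4⟩ := h.2 (max ζ η) (max_lt hζ hη)
      exact ⟨x, (key x hx ((le_max_right _ _).trans_lt h3) h4).2.2,
        (le_max_left _ _).trans_lt h3, h4⟩⟩
    have hγ'γ := he.subset γ hγ hγ'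
    obtain ⟨h3, h4⟩ := ih γ' hγ'γ (hγ'γ.trans hγ) hlt hlim'
    refine ⟨⟨hν, .step hγ' hlt hmin hγ'Z (fun hc => ?_) h3.2⟩, h4⟩
    by_contra! hb
    obtain ⟨x, hx, h5, h6⟩ := h.2 (max (b γ') η) (max_lt hb hη)
    exact ((key x hx ((le_max_right _ _).trans_lt h5) h6).2.1 hc).not_gt
      ((le_max_left _ _).trans_lt h5)

end Walk

/-! ### Clubs that hit the diamond guesses -/

/-- An unbounded subset of `(succ μ).ord` has a limit point of cofinality `μ`. -/
theorem exists_isLimitPoint_cof_eq {μ : Cardinal.{u}} (hμ : μ.IsRegular) {Z : Set Ordinal.{u}}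
    (hZ : ∀ η < (Order.succ μ).ord, ∃ ξ ∈ Z, η < ξ ∧ ξ < (Order.succ μ).ord) :
    ∃ δ < (Order.succ μ).ord, δ.cof = μ ∧ IsLimitPoint Z δ := by
  set Λ := (Order.succ μ).ord with hΛ
  -- `Order.enum` needs a set cofinal in all ordinals, hence the added tail. The first `μ` values of
  -- the enumeration stay in `Z`, and their supremum is the desired point.
  have hcof : IsCofinal (Z ∪ Ici Λ) := fun a =>
    ⟨max a Λ, Or.inr (mem_Ici.2 (le_max_right _ _)), le_max_left _ _⟩
  set f : Ordinal.{u} → Ordinal.{u} := fun i => (Order.enum (Z ∪ Ici Λ) hcof i).1 with hf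
  have hmono : StrictMono f := fun i j h => (Order.enum (Z ∪ Ici Λ) hcof).strictMono h
  have hflt : ∀ i < Λ, f i < Λ := fun i => by
    induction i using WellFoundedLT.induction with
    | ind i ih =>
    intro hi
    obtain ⟨β, hβ, hb⟩ := exists_bound_lt_succ_ord hμ.aleph0_le (ι := Iio i)
      (mk_Iio_le_of_lt_succ_ord hi) (fun j => f j) (fun j => ih j j.2 (lt_trans j.2 hi))
    obtain ⟨ξ, hξZ, h1, h2⟩ := hZ β hβ
    exact (Order.enum_le_of_forall_lt (hs := hcof) (Or.inl hξZ)
      fun j hj => (hb ⟨j, hj⟩).trans_lt h1).trans_lt h2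
  have hμΛ : μ.ord < Λ := ord_lt_ord.2 (Order.lt_succ μ)
  have hlim : Order.IsSuccLimit μ.ord := isSuccLimit_ord hμ.aleph0_le
  obtain ⟨β, hβ, hb⟩ := exists_bound_lt_succ_ord hμ.aleph0_le (ι := Iio μ.ord)
    (mk_Iio_le_of_lt_succ_ord hμΛ) (fun j => f j) (fun j => hflt j (lt_trans j.2 hμΛ))
  have hbdd : BddAbove (range fun i : Iio μ.ord => f i) := ⟨β, by rintro _ ⟨i, rfl⟩; exact hb i⟩
  have : Nonempty (Iio μ.ord) := ⟨⟨0, hlim.bot_lt⟩⟩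
  have hlt : ∀ i : Iio μ.ord, f i < ⨆ i : Iio μ.ord, f i := fun i =>
    (hmono (Order.lt_succ i.1)).trans_le (le_ciSup hbdd ⟨Order.succ i.1, hlim.succ_lt i.2⟩)
  refine ⟨⨆ i : Iio μ.ord, f i, (ciSup_le hb).trans_lt hβ, ?_, ?_, fun η hη => ?_⟩
  · rw [cof_iSup_Iio (fun i j h => hmono h) hlim.isSuccPrelimit, hμ.cof_ord]
  · exact (zero_le).trans_lt (hlt ⟨0, hlim.bot_lt⟩)
  · obtain ⟨i, hi⟩ := exists_lt_of_lt_ciSup hη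
    refine ⟨f i, ?_, hi, hlt i⟩
    rcases (Order.enum (Z ∪ Ici Λ) hcof i).2 with h | h
    · exact h
    · exact absurd (hflt i (lt_trans i.2 hμΛ)) (not_lt.2 h)

/-- `c` assigns to the ordinals `δ < (succ μ).ord` of cofinality `μ` a club of order type `μ`. -/
structure IsLadderSystem (μ : Cardinal.{u}) (c : Ordinal.{u} → Set Ordinal.{u}) : Prop where
  subset : ∀ δ < (Order.succ μ).ord, δ.cof = μ → c δ ⊆ Iio δ
  cofinal : ∀ δ < (Order.succ μ).ord, δ.cof = μ → ∀ η < δ, ∃ x ∈ c δ, η ≤ x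
  closed : ∀ δ < (Order.succ μ).ord, δ.cof = μ → ∀ ν < δ, IsLimitPoint (c δ) ν → ν ∈ c δ
  mk_lt : ∀ δ < (Order.succ μ).ord, δ.cof = μ → ∀ η < δ,
    #(c δ ∩ Iio η : Set Ordinal.{u}) < lift.{u + 1} μ

/-- The clubs `c δ` together with the guesses `G ξ` anticipate every set `A` and every closure
function `φ` at unboundedly many isolated points of some `c δ`. -/
def IsHittingSystem (μ : Cardinal.{u}) (c G : Ordinal.{u} → Set Ordinal.{u}) : Prop :=
  ∀ (A : Set Ordinal.{u}) (φ : Ordinal.{u} → Ordinal.{u}),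
    (∀ η < (Order.succ μ).ord, φ η < (Order.succ μ).ord) →
    ∃ δ < (Order.succ μ).ord, δ.cof = μ ∧ ∀ η < δ, ∃ ξ ∈ c δ, η < ξ ∧ ¬ IsLimitPoint (c δ) ξ ∧
      ClosedUnder φ ξ ∧ ∀ x < ξ, x ∈ A ↔ x ∈ G ξ

theorem IsClubSystem.isLadderSystem_walkSet {μ : Cardinal.{u}} {S Z : Set Ordinal.{u}}
    {e : Ordinal.{u} → Set Ordinal.{u}} {b : Ordinal.{u} → Ordinal.{u}} (hμ : μ.IsRegular)
    (he : IsClubSystem μ S e) (hZ : Z ⊆ S)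
    (hb : ∀ γ < (Order.succ μ).ord, γ.cof = μ → b γ < γ) :
    IsLadderSystem μ (walkSet μ e Z b) where
  subset _ _ _ _ hν := hν.1
  cofinal δ hδ _ η hη := let ⟨x, hx, hle⟩ := he.cofinal δ hδ η hη
    ⟨x, he.subset_walkSet hδ hx, hle⟩
  closed δ hδ _ ν hν h := (he.walkSet_closed hZ δ hδ ν hν h).1
  mk_lt δ hδ _ := (he.mk_walkSet_lt hμ hb δ hδ).2

/-- The ladders are walk sets with parameters `Z` and `b`, and the guesses are the coordinates `G n`
of one diamond sequence. Assuming that no choice works, the parameters are refined `ω` times: `Z`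
shrinks to the points where the current counterexample is guessed, and `b` grows. -/
theorem exists_isHittingSystem {μ : Cardinal.{u}} (hμ : ℵ₀ < μ)
    (h2 : (2 : Cardinal.{u}) ^ μ = Order.succ μ) (hlt : powerlt μ μ = μ) {S : Set Ordinal.{u}}
    (hcof : ∀ α ∈ S, α.cof < μ) (hS : StationaryIn S (Order.succ μ).ord)
    (hNR : NonReflectingIn S (Order.succ μ).ord) :
    ∃ c G : Ordinal.{u} → Set Ordinal.{u}, IsLadderSystem μ c ∧ IsHittingSystem μ c G := by
  have hreg := isRegular_of_powerlt_eq hμ.le hlt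
  obtain ⟨e, he⟩ : ∃ e, IsClubSystem μ S e := by
    have h : ∀ γ, ∃ e : Set Ordinal.{u}, γ < (Order.succ μ).ord → e ⊆ Iio γ ∧
        (∀ η < γ, ∃ x ∈ e, η ≤ x) ∧ (∀ ν < γ, IsLimitPoint e ν → ν ∈ e ∧ ν ∉ S) ∧
        #e ≤ lift.{u + 1} γ.cof ∧
        ∀ η < γ, #(e ∩ Iio η : Set Ordinal.{u}) < lift.{u + 1} γ.cof := fun γ => by
      by_cases hγ : γ < (Order.succ μ).ord
      · obtain ⟨e, he⟩ := hNR.exists_thin_club hγ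
        exact ⟨e, fun _ => he⟩
      · exact ⟨∅, fun h => absurd h hγ⟩
    choose e he using h
    exact ⟨e, fun γ hγ => (he γ hγ).1, fun γ hγ => (he γ hγ).2.1, fun γ hγ => (he γ hγ).2.2.1,
      fun γ hγ => (he γ hγ).2.2.2.1, fun γ hγ => (he γ hγ).2.2.2.2⟩
  set Λ := (Order.succ μ).ord with hΛ
  -- Values in `Set ℕ` allow countably many sets to be guessed at once; there are `2^ℵ₀ ≤ 2^μ = μ⁺`
  -- values.
  obtain ⟨g, hg⟩ := exists_diamond hμ.le h2 hlt hcof hS (ULift.{u + 1} (Set ℕ)) (by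
    rw [mk_uLift, mk_set, mk_nat, ← h2, lift_power, lift_power, lift_two, lift_two, lift_aleph0]
    exact power_le_power_left two_ne_zero (aleph0_le_lift.2 hμ.le))
  by_contra! H
  let G : ℕ → Ordinal.{u} → Set Ordinal.{u} := fun n ξ => {x | n ∈ (g ξ x).down}
  let State := {p : Set Ordinal.{u} × (Ordinal.{u} → Ordinal.{u}) //
    p.1 ⊆ S ∧ ∀ γ < Λ, γ.cof = μ → p.2 γ < γ}
  -- Points of `Z` in a walk set are isolated there. Hence failure of the hitting property bounds,
  -- in each walk set of cofinality `μ`, the points of `Z` at which the counterexample is guessed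
  -- correctly; the new `b` absorbs this bound.
  have hstep : ∀ (n : ℕ) (s : State), ∃ (t : State) (A : Set Ordinal.{u})
      (φ : Ordinal.{u} → Ordinal.{u}), (∀ η < Λ, φ η < Λ) ∧
      t.1.1 = {ξ ∈ s.1.1 | ClosedUnder φ ξ ∧ ∀ x < ξ, x ∈ A ↔ x ∈ G n ξ} ∧
      (∀ δ, s.1.2 δ ≤ t.1.2 δ) ∧
      ∀ δ < Λ, δ.cof = μ → ∀ ξ ∈ walkSet μ e s.1.1 s.1.2 δ, ξ ∈ t.1.1 → ξ ≤ t.1.2 δ := by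
    rintro n ⟨⟨Z, b⟩, hZ, hb⟩
    have hnot := H _ (G n) (he.isLadderSystem_walkSet hreg hZ hb)
    simp only [IsHittingSystem] at hnot
    push Not at hnot
    obtain ⟨A, φ, hφ, hnot⟩ := hnot
    choose! η hη hηn using hnot
    refine ⟨⟨⟨{ξ ∈ Z | ClosedUnder φ ξ ∧ ∀ x < ξ, x ∈ A ↔ x ∈ G n ξ},
      fun δ => max (b δ) (η δ)⟩, fun ξ hξ => hZ hξ.1,
      fun γ hγ hc => max_lt (hb γ hγ hc) (hη γ hγ hc)⟩, A, φ, hφ, rfl, fun δ => le_max_left _ _,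
      fun δ hδ hc ξ hξ hξ' => ?_⟩
    refine le_trans ?_ (le_max_right _ _)
    by_contra! hlt
    obtain ⟨x, hx, hx'⟩ := hηn δ hδ hc ξ hξ hlt
      (fun hl => (he.walkSet_closed hZ δ hδ ξ hξ.1 hl).2 hξ'.1) hξ'.2.1
    have := hξ'.2.2 x hx
    tauto
  choose next A φ hφ hZ hmono hbd using hstep
  have hpos : ∀ γ < Λ, γ.cof = μ → (0 : Ordinal.{u}) < γ := fun γ _ hc => by
    rw [← cof_pos, hc]; exact aleph0_pos.trans hμ
  let s : ℕ → State := fun n => Nat.rec ⟨⟨S, fun _ => 0⟩, subset_rfl, hpos⟩ (fun n t => next n t) n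
  let Z : ℕ → Set Ordinal.{u} := fun n => (s n).1.1
  let b : ℕ → Ordinal.{u} → Ordinal.{u} := fun n => (s n).1.2
  have hZs : ∀ n, Z (n + 1) = {ξ ∈ Z n | ClosedUnder (φ n (s n)) ξ ∧
      ∀ x < ξ, x ∈ A n (s n) ↔ x ∈ G n ξ} := fun n => hZ n (s n)
  have hbs : ∀ n, ∀ δ < Λ, δ.cof = μ → ∀ ξ ∈ walkSet μ e (Z n) (b n) δ, ξ ∈ Z (n + 1) →
      ξ ≤ b (n + 1) δ := fun n => hbd n (s n)
  have hbmono : ∀ δ, Monotone fun n => b n δ := fun δ =>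
    monotone_nat_of_le_succ fun n => hmono n (s n) δ
  have hZanti : Antitone Z := antitone_nat_of_succ_le fun n => by
    rw [hZs]; exact fun ξ hξ => hξ.1
  set Zω : Set Ordinal.{u} := ⋂ n, Z n with hZω
  -- Diamond applied to the whole sequence of counterexamples gives points of `S` that survive every
  -- refinement.
  have hstat : ∀ η < Λ, ∃ ξ ∈ Zω, η < ξ ∧ ξ < Λ := by
    intro η₀ hη₀
    have hsup : ∀ η, ∃ β, η < Λ → β < Λ ∧ ∀ n, φ n (s n) η ≤ β := fun η => by
      by_cases hη : η < Λ
      · obtain ⟨β, h1, h2⟩ := exists_bound_lt_succ_ord hμ.le (ι := ULift.{u + 1} ℕ)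
          (by simpa using hμ.le) (fun n => φ n.down (s n.down) η) (fun n => hφ _ _ η hη)
        exact ⟨β, fun _ => ⟨h1, fun n => h2 ⟨n⟩⟩⟩
      · exact ⟨0, fun h => absurd h hη⟩
    choose ψ hψ using hsup
    obtain ⟨ξ, hξS, hξΛ, ⟨hξ0, hξ⟩, hguess⟩ := hg (fun x => ⟨{n | x ∈ A n (s n)}⟩)
      (fun η => max (ψ η) η₀) (fun η hη => max_lt (hψ η hη).1 hη₀)
    refine ⟨ξ, mem_iInter.2 fun n => ?_, (le_max_right _ _).trans_lt (hξ 0 hξ0), hξΛ⟩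
    induction n with
    | zero => exact hξS
    | succ n ih =>
      rw [hZs]
      refine ⟨ih, ⟨hξ0, fun η hη => ((hψ η (hη.trans hξΛ)).2 n).trans_lt
        ((le_max_left _ _).trans_lt (hξ η hη))⟩, fun x hx => ?_⟩
      simp only [G]
      rw [mem_ofPred_eq, ← hguess x hx]
      rfl
  -- Walk from `γ` towards `ξ` until a point of `Zω` is met. An intermediate `γ' ∉ Zω` has left `Z
  -- n` for large `n`, so it no longer stops the walk. When `cof γ' = μ`, the next bound `b` at `γ'`
  -- already lies above `ν`, so the cut-off does not stop it either.
  have hreach : ∀ γ < Λ, ∀ ξ ∈ Zω, ξ < γ → ∃ ν ∈ Zω, ξ ≤ ν ∧ ν < γ ∧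
      ∃ n₀, ∀ n ≥ n₀, ν ∈ walkSet μ e (Z n) (b n) γ := by
    intro γ
    induction γ using WellFoundedLT.induction with
    | ind γ ih =>
    intro hγ ξ hξ hξγ
    obtain ⟨γ', hγ', hle, hmin⟩ := he.exists_min hγ hξγ
    have hγ'γ := he.subset γ hγ hγ'
    by_cases hmem : γ' ∈ Zω
    · exact ⟨γ', hmem, hle, hγ'γ, 0, fun n _ => he.subset_walkSet hγ hγ'⟩
    · have hlt : ξ < γ' := hle.lt_of_ne (by rintro rfl; exact hmem hξ)
      obtain ⟨ν, hν, h1, h3, n₀, h4⟩ := ih γ' hγ'γ (hγ'γ.trans hγ) ξ hξ hlt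
      obtain ⟨m, hm⟩ : ∃ m, γ' ∉ Z m := by simpa [hZω] using hmem
      refine ⟨ν, hν, h1, h3.trans hγ'γ, max m (n₀ + 1), fun n hn => ⟨h3.trans hγ'γ, ?_⟩⟩
      refine .step hγ' h3 (fun x hx hx' => hmin x hx (h1.trans hx'))
        (fun h => hm (hZanti ((le_max_left _ _).trans hn) h)) (fun hc => ?_)
        (h4 n (by have := le_max_right m (n₀ + 1); omega)).2
      exact (hbs n₀ γ' (hγ'γ.trans hγ) hc ν (h4 n₀ le_rfl) (mem_iInter.1 hν (n₀ + 1))).trans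
        (hbmono γ' ((le_max_right _ _).trans hn))
  obtain ⟨δ, hδ, hδμ, hδlim⟩ := exists_isLimitPoint_cof_eq hreg hstat
  -- Since `cof δ = μ > ℵ₀`, all the bounds `b n δ` lie below one `β < δ`. A point of `Zω` above `β`
  -- leads to some `ν ≥ ξ > β` in a walk set of `δ`, although `ν ≤ b (n₀ + 1) δ ≤ β`.
  obtain ⟨β, hβ, hβb⟩ := exists_bound_of_mk_lt_cof (X := range fun n => b n δ) (δ := δ) (by
      rw [hδμ]
      refine lt_of_le_of_lt (countable_range _).le_aleph0 ?_
      rwa [aleph0_lt_lift]) (by rintro _ ⟨n, rfl⟩; exact (s n).2.2 δ hδ hδμ)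
  obtain ⟨ξ, hξ, h1, h3⟩ := hδlim.2 β hβ
  obtain ⟨ν, hν, h4, -, n₀, h5⟩ := hreach δ hδ ξ hξ h3
  have h6 := hbs n₀ δ hδ hδμ ν (h5 n₀ le_rfl) (mem_iInter.1 hν (n₀ + 1))
  exact ((h6.trans (hβb _ ⟨n₀ + 1, rfl⟩)).trans_lt (h1.trans_le h4)).false

/-! ### Recursion along a closed set -/

theorem inter_Iio_inter_Iio {t : Set Ordinal.{u}} {η i : Ordinal.{u}} (h : η ≤ i) :
    t ∩ Iio i ∩ Iio η = t ∩ Iio η := by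
  rw [inter_assoc, Iio_inter_Iio, min_eq_right h]

theorem inter_Iio_eq_of_inter_Iio_eq {t t' : Set Ordinal.{u}} {η i : Ordinal.{u}} (h : η ≤ i)
    (h' : t ∩ Iio i = t' ∩ Iio i) : t ∩ Iio η = t' ∩ Iio η := by
  rw [← inter_Iio_inter_Iio h, h', inter_Iio_inter_Iio h]

/-- If the supremum of `c ∩ ν` were not attained, it would be a limit point of `c`, so either `ν`
itself or an element of `c ∩ ν`. -/
theorem exists_max_of_not_isLimitPoint {c : Set Ordinal.{u}} {δ ν i : Ordinal.{u}} (hν : ν < δ)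
    (hcl : ∀ ν < δ, IsLimitPoint c ν → ν ∈ c) (hi : i ∈ c) (hiν : i < ν)
    (hlim : ¬ IsLimitPoint c ν) : ∃ p ∈ c, i ≤ p ∧ p < ν ∧ ∀ j ∈ c, j < ν → j ≤ p := by
  have hbdd : BddAbove (c ∩ Iio ν) := ⟨ν, fun x hx => hx.2.le⟩
  have hne : (c ∩ Iio ν).Nonempty := ⟨i, hi, hiν⟩
  by_cases hmem : sSup (c ∩ Iio ν) ∈ c ∩ Iio ν
  · exact ⟨_, hmem.1, le_csSup hbdd ⟨hi, hiν⟩, hmem.2, fun j hj hjν => le_csSup hbdd ⟨hj, hjν⟩⟩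
  · exfalso
    have hlt : ∀ x ∈ c ∩ Iio ν, x < sSup (c ∩ Iio ν) := fun x hx =>
      (le_csSup hbdd hx).lt_of_ne (by rintro rfl; exact hmem hx)
    have hL : IsLimitPoint c (sSup (c ∩ Iio ν)) := by
      refine ⟨(zero_le).trans_lt (hlt i ⟨hi, hiν⟩), fun η hη => ?_⟩
      obtain ⟨x, hx, h⟩ := exists_lt_of_lt_csSup hne hη
      exact ⟨x, hx.1, h, hlt x hx⟩
    have hle : sSup (c ∩ Iio ν) ≤ ν := csSup_le hne fun x hx => hx.2.le
    rcases hle.eq_or_lt with h | h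
    · exact hlim (h ▸ hL)
    · exact hmem ⟨hcl _ (h.trans hν) hL, h⟩

/-- Building a set of ordinals by recursion along a closed cofinal set `c`: a property `Q` of its
initial segments can be maintained if it can be passed to the next element of `c` and to limits. -/
theorem exists_set_of_recursion {δ i₀ : Ordinal.{u}} {c x : Set Ordinal.{u}} (hc : c ⊆ Iio δ)
    (hcl : ∀ ν < δ, IsLimitPoint c ν → ν ∈ c) {Q : Ordinal.{u} → Set Ordinal.{u} → Prop}
    (hQ : ∀ ν t, Q ν t → t ⊆ Iio ν) (hi₀ : i₀ ∈ c) (hx : Q i₀ x)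
    (hsucc : ∀ i ∈ c, i₀ ≤ i → ∀ ν ∈ c, i < ν → (∀ j ∈ c, j < ν → j ≤ i) → ∀ t, Q i t →
      ∃ t', Q ν t' ∧ t' ∩ Iio i = t)
    (hlimit : ∀ ν ∈ c, IsLimitPoint c ν → i₀ < ν → ∀ t ⊆ Iio ν,
      (∀ i ∈ c, i₀ ≤ i → i < ν → Q i (t ∩ Iio i)) → Q ν t) :
    ∃ t ⊆ Iio δ, t ∩ Iio i₀ = x ∧ ∀ i ∈ c, i₀ ≤ i → Q i (t ∩ Iio i) := by
  classical
  choose! F hF1 hF2 using hsucc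
  choose! p hpc hip hpν hpmax using fun ν (h : ν < δ ∧ i₀ < ν ∧ ¬ IsLimitPoint c ν) =>
    exists_max_of_not_isLimitPoint h.1 hcl hi₀ h.2.1 h.2.2
  -- Take unions at limit points of `c` and apply `F` to the predecessor `p ν` elsewhere. The test
  -- `p ν < ν` serves the well-founded recursion; it can only fail for `ν ≥ δ`.
  let g : Ordinal.{u} → Set Ordinal.{u} := Ordinal.lt_wf.fix fun ν prev =>
    if ν ≤ i₀ then x else if IsLimitPoint c ν then
      {y | ∃ j, ∃ h : j < ν, j ∈ c ∧ i₀ ≤ j ∧ y ∈ prev j h}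
    else if h : p ν < ν then F (p ν) ν (prev (p ν) h) else ∅
  have hg : ∀ ν, g ν = if ν ≤ i₀ then x else if IsLimitPoint c ν then
      {y | ∃ j, ∃ _ : j < ν, j ∈ c ∧ i₀ ≤ j ∧ y ∈ g j}
    else if p ν < ν then F (p ν) ν (g (p ν)) else ∅ := fun ν => by
    simp only [g]
    rw [WellFounded.fix_eq]
    rfl
  have union_inter : ∀ ρ, (∀ ν < ρ, ν ∈ c → i₀ ≤ ν → Q ν (g ν) ∧
      ∀ j ∈ c, i₀ ≤ j → j ≤ ν → g ν ∩ Iio j = g j) → ∀ i ∈ c, i₀ ≤ i → i < ρ →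
      {y | ∃ j, ∃ _ : j < ρ, j ∈ c ∧ i₀ ≤ j ∧ y ∈ g j} ∩ Iio i = g i := by
    intro ρ ih i hi h0 hiρ
    ext y
    constructor
    · rintro ⟨⟨j, hj, hjc, hj0, hy⟩, hyi⟩
      rcases le_total j i with h | h
      · rw [← (ih i hiρ hi h0).2 j hjc hj0 h] at hy
        exact hy.1
      · rw [← (ih j hj hjc hj0).2 i hi h0 h]
        exact ⟨hy, hyi⟩
    · exact fun hy => ⟨⟨i, hiρ, hi, h0, hy⟩, hQ i _ (ih i hiρ hi h0).1 hy⟩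
  have key : ∀ ν ∈ c, i₀ ≤ ν → Q ν (g ν) ∧ ∀ j ∈ c, i₀ ≤ j → j ≤ ν → g ν ∩ Iio j = g j := by
    intro ν
    induction ν using WellFoundedLT.induction with
    | ind ν ih =>
    intro hν h0
    suffices h : Q ν (g ν) ∧ ∀ j ∈ c, i₀ ≤ j → j < ν → g ν ∩ Iio j = g j by
      refine ⟨h.1, fun j hj hj0 hle => ?_⟩
      rcases hle.eq_or_lt with rfl | hlt
      · exact inter_eq_left.2 (hQ j _ h.1)
      · exact h.2 j hj hj0 hlt
    rcases h0.eq_or_lt with rfl | h0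
    · rw [hg, if_pos le_rfl]
      exact ⟨hx, fun j _ h1 h2 => absurd h1 h2.not_ge⟩
    by_cases hl : IsLimitPoint c ν
    · have hu := union_inter ν ih
      rw [hg, if_neg h0.not_ge, if_pos hl]
      refine ⟨hlimit ν hν hl h0 _ ?_ fun i hi hi0 hiν => ?_, hu⟩
      · rintro y ⟨j, hj, hjc, hj0, hy⟩
        exact lt_trans (hQ j _ (ih j hj hjc hj0).1 hy) hj
      · rw [hu i hi hi0 hiν]
        exact (ih i hiν hi hi0).1
    · have hh := (⟨hc hν, h0, hl⟩ : ν < δ ∧ i₀ < ν ∧ ¬ IsLimitPoint c ν)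
      rw [hg, if_neg h0.not_ge, if_neg hl, if_pos (hpν ν hh)]
      obtain ⟨hq, hco⟩ := ih _ (hpν ν hh) (hpc ν hh) (hip ν hh)
      refine ⟨hF1 _ (hpc ν hh) (hip ν hh) ν hν (hpν ν hh) (hpmax ν hh) _ hq,
        fun j hj hj0 hjν => ?_⟩
      have hjp := hpmax ν hh j hj hjν
      rw [← hco j hj hj0 hjp,
        ← hF2 _ (hpc ν hh) (hip ν hh) ν hν (hpν ν hh) (hpmax ν hh) _ hq,
        inter_Iio_inter_Iio hjp]
      congr 2
      rw [hF2 _ (hpc ν hh) (hip ν hh) ν hν (hpν ν hh) (hpmax ν hh) _ hq]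
  have hu := union_inter δ fun ν _ => key ν
  refine ⟨{y | ∃ j, ∃ _ : j < δ, j ∈ c ∧ i₀ ≤ j ∧ y ∈ g j}, ?_, ?_, fun i hi hi0 => ?_⟩
  · rintro y ⟨j, hj, hjc, hj0, hy⟩
    exact lt_trans (hQ j _ (key j hjc hj0).1 hy) hj
  · rw [hu i₀ hi₀ le_rfl (hc hi₀), hg, if_pos le_rfl]
  · rw [hu i hi hi0 (hc hi)]
    exact (key i hi hi0).1

/-! ### The levels of the tree -/

section Tree

variable (μ : Cardinal.{u}) (c G : Ordinal.{u} → Set Ordinal.{u})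
  (code : Ordinal.{u} → Set Ordinal.{u} → Ordinal.{u})

/-- `t` is a branch of length `α` through the levels `L`. -/
def IsBranch (L : Ordinal.{u} → Set (Set Ordinal.{u})) (α : Ordinal.{u}) (t : Set Ordinal.{u}) :
    Prop :=
  t ⊆ Iio α ∧ ∀ β < α, t ∩ Iio β ∈ L β

/-- Before `ξ`, the branch `t` passes through an element of the set of nodes coded by `G ξ`, or no
node on a level below `ξ` above some initial segment of `t` does. -/
def Sealed (L : Ordinal.{u} → Set (Set Ordinal.{u})) (ξ : Ordinal.{u}) (t : Set Ordinal.{u}) :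
    Prop :=
  ∃ ζ < ξ, (∃ η ≤ ζ, code η (t ∩ Iio η) ∈ G ξ) ∨
    ∀ ζ' < ξ, ζ ≤ ζ' → ∀ w ∈ L ζ', w ∩ Iio ζ = t ∩ Iio ζ → ∀ η ≤ ζ', code η (w ∩ Iio η) ∉ G ξ

/-- `t` is a branch of length `δ` through `x` which is sealed at the isolated points of a tail of
the club `c δ`. -/
def IsSealingBranch (L : Ordinal.{u} → Set (Set Ordinal.{u})) (δ β : Ordinal.{u})
    (x t : Set Ordinal.{u}) : Prop :=
  IsBranch L δ t ∧ t ∩ Iio β = x ∧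
    ∃ i < δ, ∀ ξ ∈ c δ, ξ < δ → i < ξ → ¬ IsLimitPoint (c δ) ξ → Sealed G code L ξ t

open Classical in
/-- The next level of the tree: all branches if the cofinality is not `μ`, and one sealing branch
through every node otherwise. -/
noncomputable def nextLevel (L : Ordinal.{u} → Set (Set Ordinal.{u})) (α : Ordinal.{u}) :
    Set (Set Ordinal.{u}) :=
  if α.cof = μ then
    {t | ∃ β < α, ∃ x ∈ L β, t = Classical.epsilon (IsSealingBranch c G code L α β x) ∧
      IsSealingBranch c G code L α β x t}
  else {t | IsBranch L α t}

open Classical in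
/-- The levels of the tree; the nodes are sets of ordinals, ordered by end-extension. -/
noncomputable def treeLevel : Ordinal.{u} → Set (Set Ordinal.{u}) :=
  Ordinal.lt_wf.fix fun α prev =>
    nextLevel μ c G code (fun β => if h : β < α then prev β h else ∅) α

variable {μ c G code}

/-- This and the following congruences show that `nextLevel` at `α` reads only the levels below `α`,
which turns the well-founded recursion into the equation `treeLevel_eq`. -/
theorem isBranch_congr {L L' : Ordinal.{u} → Set (Set Ordinal.{u})} {α : Ordinal.{u}}
    (h : ∀ β < α, L β = L' β) : IsBranch L α = IsBranch L' α := by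
  funext t
  exact propext (and_congr_right fun _ => forall₂_congr fun β hβ => by rw [h β hβ])

theorem sealed_congr {L L' : Ordinal.{u} → Set (Set Ordinal.{u})} {ξ : Ordinal.{u}}
    (h : ∀ β < ξ, L β = L' β) : Sealed G code L ξ = Sealed G code L' ξ := by
  funext t
  refine propext (exists_congr fun ζ => and_congr_right fun _ => or_congr_right ?_)
  exact forall₂_congr fun ζ' hζ' => by rw [h ζ' hζ']

theorem isSealingBranch_congr {L L' : Ordinal.{u} → Set (Set Ordinal.{u})} {δ β : Ordinal.{u}}
    {x : Set Ordinal.{u}} (h : ∀ β < δ, L β = L' β) :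
    IsSealingBranch c G code L δ β x = IsSealingBranch c G code L' δ β x := by
  funext t
  rw [IsSealingBranch, IsSealingBranch, isBranch_congr h]
  refine propext (and_congr_right fun _ => and_congr_right fun _ => exists_congr fun i =>
    and_congr_right fun _ => forall₃_congr fun ξ _ hξ => ?_)
  rw [sealed_congr fun β hβ => h β (hβ.trans hξ)]

theorem nextLevel_congr {L L' : Ordinal.{u} → Set (Set Ordinal.{u})} {α : Ordinal.{u}}
    (h : ∀ β < α, L β = L' β) : nextLevel μ c G code L α = nextLevel μ c G code L' α := by
  rw [nextLevel, nextLevel, isBranch_congr h]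
  congr 1
  ext t
  refine exists_congr fun β => and_congr_right fun hβ => ?_
  rw [h β hβ]
  refine exists_congr fun x => and_congr_right fun _ => ?_
  rw [isSealingBranch_congr h]

theorem treeLevel_eq (α : Ordinal.{u}) :
    treeLevel μ c G code α = nextLevel μ c G code (treeLevel μ c G code) α := by
  conv_lhs => rw [treeLevel, WellFounded.fix_eq]
  exact nextLevel_congr fun β hβ => dif_pos hβ

theorem mem_treeLevel_of_cof_ne {α : Ordinal.{u}} (hα : α.cof ≠ μ) {t : Set Ordinal.{u}} :
    t ∈ treeLevel μ c G code α ↔ IsBranch (treeLevel μ c G code) α t := by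
  rw [treeLevel_eq, nextLevel, if_neg hα]
  rfl

theorem mem_treeLevel_of_cof_eq {α : Ordinal.{u}} (hα : α.cof = μ) {t : Set Ordinal.{u}} :
    t ∈ treeLevel μ c G code α ↔ ∃ β < α, ∃ x ∈ treeLevel μ c G code β,
      t = Classical.epsilon (IsSealingBranch c G code (treeLevel μ c G code) α β x) ∧
      IsSealingBranch c G code (treeLevel μ c G code) α β x t := by
  rw [treeLevel_eq, nextLevel, if_pos hα]
  rfl

theorem isBranch_of_mem_treeLevel {α : Ordinal.{u}} {t : Set Ordinal.{u}}
    (h : t ∈ treeLevel μ c G code α) : IsBranch (treeLevel μ c G code) α t := by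
  by_cases hα : α.cof = μ
  · obtain ⟨-, -, -, -, -, h, -⟩ := (mem_treeLevel_of_cof_eq hα).1 h
    exact h
  · exact (mem_treeLevel_of_cof_ne hα).1 h

theorem inter_Iio_mem_treeLevel {α β : Ordinal.{u}} {t : Set Ordinal.{u}}
    (h : t ∈ treeLevel μ c G code α) (hβ : β ≤ α) : t ∩ Iio β ∈ treeLevel μ c G code β := by
  have hb := isBranch_of_mem_treeLevel h
  rcases hβ.eq_or_lt with rfl | hlt
  · rwa [inter_eq_left.2 hb.1]
  · exact hb.2 β hlt

theorem exists_mem_treeLevel_of_isSealingBranch {α β : Ordinal.{u}} (hα : α.cof = μ)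
    {x t : Set Ordinal.{u}} (hβ : β < α) (hx : x ∈ treeLevel μ c G code β)
    (ht : IsSealingBranch c G code (treeLevel μ c G code) α β x t) :
    ∃ t ∈ treeLevel μ c G code α, t ∩ Iio β = x := by
  have h := Classical.epsilon_spec (p := IsSealingBranch c G code (treeLevel μ c G code) α β x)
    ⟨t, ht⟩
  exact ⟨_, (mem_treeLevel_of_cof_eq hα).2 ⟨β, hβ, x, hx, rfl, h⟩, h.2.1⟩

theorem Sealed.congr {L : Ordinal.{u} → Set (Set Ordinal.{u})} {ξ : Ordinal.{u}}
    {t t' : Set Ordinal.{u}} (h : Sealed G code L ξ t) (htt' : t ∩ Iio ξ = t' ∩ Iio ξ) :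
    Sealed G code L ξ t' := by
  obtain ⟨ζ, hζ, h⟩ := h
  have heq : ∀ η ≤ ζ, t ∩ Iio η = t' ∩ Iio η := fun η hη =>
    inter_Iio_eq_of_inter_Iio_eq (hη.trans hζ.le) htt'
  refine ⟨ζ, hζ, h.imp ?_ ?_⟩
  · rintro ⟨η, hη, h⟩
    exact ⟨η, hη, heq η hη ▸ h⟩
  · rw [heq ζ le_rfl]; exact id

end Tree

/-! ### Extending nodes to higher levels -/

section Tree

variable {μ : Cardinal.{u}} {c G : Ordinal.{u} → Set Ordinal.{u}}
  {code : Ordinal.{u} → Set Ordinal.{u} → Ordinal.{u}}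

/-- Build the branch along `d`, sealing at each isolated point above the start. Limit points of `d`
below `δ` have cofinality less than `μ` because `d` has small initial segments, so their levels
contain every branch and the recursion continues. -/
theorem exists_sealed_branch {δ β : Ordinal.{u}} {d x : Set Ordinal.{u}} (hd : d ⊆ Iio δ)
    (hcof : ∀ η < δ, ∃ i ∈ d, η ≤ i) (hcl : ∀ ν < δ, IsLimitPoint d ν → ν ∈ d)
    (hsmall : ∀ η < δ, #(d ∩ Iio η : Set Ordinal.{u}) < lift.{u + 1} μ)
    (hext : ∀ ν < δ, ∀ η ≤ ν, ∀ y ∈ treeLevel μ c G code η,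
      ∃ t ∈ treeLevel μ c G code ν, t ∩ Iio η = y)
    (hβ : β < δ) (hx : x ∈ treeLevel μ c G code β) :
    ∃ t, IsBranch (treeLevel μ c G code) δ t ∧ t ∩ Iio β = x ∧ ∃ i < δ, ∀ ξ ∈ d, ξ < δ → i < ξ →
      ¬ IsLimitPoint d ξ → Sealed G code (treeLevel μ c G code) ξ t := by
  obtain ⟨i₀, hi₀, hβi⟩ := hcof β hβ
  obtain ⟨x₀, hx₀, rfl⟩ := hext i₀ (hd hi₀) β hβi x hx
  let Q : Ordinal.{u} → Set Ordinal.{u} → Prop := fun ν t => t ∈ treeLevel μ c G code ν ∧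
    ∀ ξ ∈ d, i₀ < ξ → ξ ≤ ν → ¬ IsLimitPoint d ξ → Sealed G code (treeLevel μ c G code) ξ t
  obtain ⟨t, htδ, htx, ht⟩ : ∃ t ⊆ Iio δ, t ∩ Iio i₀ = x₀ ∧ ∀ i ∈ d, i₀ ≤ i → Q i (t ∩ Iio i) := by
    refine exists_set_of_recursion hd hcl (fun ν t h => (isBranch_of_mem_treeLevel h.1).1) hi₀
      ⟨hx₀, fun ξ _ h1 h2 => absurd h1 h2.not_gt⟩ ?_ ?_
    · rintro i hi hi0 ν hν hiν hmax t ⟨ht, hts⟩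
      have of_isolated : ∀ t' ∈ treeLevel μ c G code ν, t' ∩ Iio i = t →
          Sealed G code (treeLevel μ c G code) ν t' → ∀ ξ ∈ d, i₀ < ξ → ξ ≤ ν →
          ¬ IsLimitPoint d ξ → Sealed G code (treeLevel μ c G code) ξ t' := by
        rintro t' - rfl hs ξ hξ hξ0 hξν hl
        rcases hξν.eq_or_lt with rfl | hlt
        · exact hs
        · have hξi := hmax ξ hξ hlt
          exact (hts ξ hξ hξ0 hξi hl).congr (inter_Iio_inter_Iio hξi)
      -- If some extension of `t` below `ν` passes through a node coded in `G ν`, follow it.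
      -- Otherwise any extension is sealed by the second alternative, with `ζ = i`.
      by_cases H : ∃ ζ < ν, i ≤ ζ ∧ ∃ w ∈ treeLevel μ c G code ζ, w ∩ Iio i = t ∧
          ∃ η ≤ ζ, code η (w ∩ Iio η) ∈ G ν
      · obtain ⟨ζ, hζ, hiζ, w, hw, hwt, η, hη, hG⟩ := H
        obtain ⟨t', ht', rfl⟩ := hext ν (hd hν) ζ hζ.le w hw
        rw [inter_Iio_inter_Iio hiζ] at hwt
        rw [inter_Iio_inter_Iio hη] at hG
        exact ⟨t', ⟨ht', of_isolated t' ht' hwt ⟨ζ, hζ, Or.inl ⟨η, hη, hG⟩⟩⟩, hwt⟩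
      · push Not at H
        obtain ⟨t', ht', htt'⟩ := hext ν (hd hν) i hiν.le t ht
        refine ⟨t', ⟨ht', of_isolated t' ht' htt' ⟨i, hiν, Or.inr ?_⟩⟩, htt'⟩
        rw [htt']
        exact H
    · intro ν hν hl hi0 t htν ht
      have hcofν : ν.cof ≠ μ := by
        rintro rfl
        exact (hsmall ν (hd hν)).not_ge hl.cof_le_mk
      refine ⟨(mem_treeLevel_of_cof_ne hcofν).2 ⟨htν, fun η hη => ?_⟩, fun ξ hξ hξ0 hξν hξl => ?_⟩
      · obtain ⟨i, hi, h1, h2⟩ := hl.2 _ (max_lt hη hi0)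
        have := inter_Iio_mem_treeLevel (ht i hi ((le_max_right _ _).trans h1.le) h2).1
          ((le_max_left _ _).trans h1.le)
        rwa [inter_Iio_inter_Iio ((le_max_left _ _).trans h1.le)] at this
      · have hlt : ξ < ν := hξν.lt_of_ne (by rintro rfl; exact hξl hl)
        exact ((ht ξ hξ hξ0.le hlt).2 ξ hξ hξ0 le_rfl hξl).congr (inter_Iio_inter_Iio le_rfl)
  refine ⟨t, ⟨htδ, fun η hη => ?_⟩, ?_, i₀, hd hi₀, fun ξ hξ _ hi hl => ?_⟩
  · obtain ⟨i, hi, hηi⟩ := hcof _ (max_lt hη (hd hi₀))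
    have := inter_Iio_mem_treeLevel (ht i hi ((le_max_right _ _).trans hηi)).1
      ((le_max_left _ _).trans hηi)
    rwa [inter_Iio_inter_Iio ((le_max_left _ _).trans hηi)] at this
  · rw [← htx, inter_Iio_inter_Iio hβi]
  · exact ((ht ξ hξ hi.le).2 ξ hξ hi le_rfl hl).congr (inter_Iio_inter_Iio le_rfl)

theorem exists_treeLevel_extension (hc : IsLadderSystem μ c) {δ β : Ordinal.{u}}
    (hδ : δ < (Order.succ μ).ord) (hβ : β ≤ δ) {x : Set Ordinal.{u}}
    (hx : x ∈ treeLevel μ c G code β) : ∃ t ∈ treeLevel μ c G code δ, t ∩ Iio β = x := by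
  induction δ using WellFoundedLT.induction generalizing β x with
  | ind δ ih =>
  have hext : ∀ ν < δ, ∀ η ≤ ν, ∀ y ∈ treeLevel μ c G code η,
      ∃ t ∈ treeLevel μ c G code ν, t ∩ Iio η = y := fun ν hν η hη y hy =>
    ih ν hν (hν.trans hδ) hη hy
  rcases hβ.eq_or_lt with rfl | hβ
  · exact ⟨x, hx, inter_eq_left.2 (isBranch_of_mem_treeLevel hx).1⟩
  by_cases hcof : δ.cof = μ
  · obtain ⟨t, ht⟩ := exists_sealed_branch (hc.subset δ hδ hcof) (hc.cofinal δ hδ hcof)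
      (hc.closed δ hδ hcof) (hc.mk_lt δ hδ hcof) hext hβ hx
    exact exists_mem_treeLevel_of_isSealingBranch hcof hβ hx ht
  -- Here only a short closed cofinal set is needed, so the empty set replaces `S` and the sealing
  -- information is discarded.
  · have hNR : NonReflectingIn (∅ : Set Ordinal.{u}) (Order.succ μ).ord :=
      fun _ _ _ => not_isStationary_empty
    obtain ⟨e, he, hecof, hecl, -, hesmall⟩ := hNR.exists_thin_club hδ
    obtain ⟨t, ht, htx, -⟩ := exists_sealed_branch he hecof (fun ν hν h => (hecl ν hν h).1)
      (fun η hη => (hesmall η hη).trans_le (Cardinal.lift_le.2 (cof_le_of_lt_succ_ord hδ)))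
      hext hβ hx
    exact ⟨t, (mem_treeLevel_of_cof_ne hcof).2 ht, htx⟩

end Tree

/-! ### Coding of nodes and size of levels -/

/-- An injective coding of the bounded subsets of `(succ μ).ord`, with their bounds, by ordinals. -/
def IsCoding (μ : Cardinal.{u}) (code : Ordinal.{u} → Set Ordinal.{u} → Ordinal.{u}) : Prop :=
  (∀ α < (Order.succ μ).ord, ∀ t ⊆ Iio α, code α t < (Order.succ μ).ord) ∧
    ∀ α < (Order.succ μ).ord, ∀ t ⊆ Iio α, ∀ β < (Order.succ μ).ord, ∀ s ⊆ Iio β,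
      code α t = code β s → α = β ∧ t = s

theorem mk_biUnion_Iio_le {κ : Cardinal.{u + 1}} (hκ : ℵ₀ ≤ κ) {α : Ordinal.{u}}
    (hα : #(Iio α) ≤ κ) {β : Type (u + 1)} {f : Ordinal.{u} → Set β} (h : ∀ i < α, #(f i) ≤ κ) :
    #(⋃ i : Iio α, f i.1 : Set β) ≤ κ := by
  refine (mk_iUnion_le_sum_mk).trans ?_
  refine (Cardinal.sum_le_sum (fun i : Iio α => #(f i)) (fun _ => κ) fun i => h i.1 i.2).trans ?_
  rw [sum_const, Cardinal.lift_id, Cardinal.lift_id]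
  exact (mul_le_mul_left hα _).trans (mul_eq_self hκ).le

theorem exists_isCoding {μ : Cardinal.{u}} (hμ : ℵ₀ ≤ μ)
    (h2 : (2 : Cardinal.{u}) ^ μ = Order.succ μ) : ∃ code, IsCoding μ code := by
  let f : Ordinal.{u} → Set (Ordinal.{u} × Set Ordinal.{u}) := fun α => Prod.mk α '' 𝒫 (Iio α)
  have hD : #(⋃ α : Iio (Order.succ μ).ord, f α : Set (Ordinal.{u} × Set Ordinal.{u})) ≤
      #(Iio (Order.succ μ).ord) := by
    have hΛ : #(Iio (Order.succ μ).ord) = lift.{u + 1} (Order.succ μ) := by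
      rw [Cardinal.mk_Iio_ordinal, card_ord]
    rw [hΛ]
    refine mk_biUnion_Iio_le ?_ hΛ.le fun α hα => mk_image_le.trans ?_
    · rw [aleph0_le_lift]; exact hμ.trans (Order.le_succ μ)
    · rw [mk_powerset, ← h2, lift_power, lift_two]
      exact power_le_power_left two_ne_zero (mk_Iio_le_of_lt_succ_ord hα)
  obtain ⟨g⟩ := hD
  classical
  have hmem : ∀ α < (Order.succ μ).ord, ∀ t ⊆ Iio α,
      (α, t) ∈ ⋃ α : Iio (Order.succ μ).ord, f α := fun α hα t ht =>
    mem_iUnion.2 ⟨⟨α, hα⟩, t, ht, rfl⟩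
  refine ⟨fun α t => if h : (α, t) ∈ ⋃ α : Iio (Order.succ μ).ord, f α then g ⟨_, h⟩ else 0,
    fun α hα t ht => ?_, fun α hα t ht β hβ s hs h => ?_⟩
  · simp only [dif_pos (hmem α hα t ht)]
    exact (g _).2
  · simp only [dif_pos (hmem α hα t ht), dif_pos (hmem β hβ s hs)] at h
    have := congrArg Subtype.val (g.injective (Subtype.ext h))
    exact ⟨congrArg Prod.fst this, congrArg Prod.snd this⟩

/-- In cofinality `μ`, the choice by `Classical.epsilon` gives at most one node for each earlier
node. Otherwise a branch is determined by its traces on a cofinal set of size less than `μ`, and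
`μ^{<μ} = μ` applies. -/
theorem mk_treeLevel_le {μ : Cardinal.{u}} {c G : Ordinal.{u} → Set Ordinal.{u}}
    {code : Ordinal.{u} → Set Ordinal.{u} → Ordinal.{u}} (hμ : ℵ₀ ≤ μ) (hlt : powerlt μ μ = μ)
    {α : Ordinal.{u}} (hα : α < (Order.succ μ).ord) :
    #(treeLevel μ c G code α) ≤ lift.{u + 1} μ := by
  induction α using WellFoundedLT.induction with
  | ind α ih =>
  have hK : ℵ₀ ≤ lift.{u + 1} μ := aleph0_le_lift.2 hμ
  by_cases hcof : α.cof = μ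
  · refine (mk_le_mk_of_subset ?_).trans (mk_biUnion_Iio_le hK (mk_Iio_le_of_lt_succ_ord hα)
      (f := fun β => (fun x => Classical.epsilon
        (IsSealingBranch c G code (treeLevel μ c G code) α β x)) '' treeLevel μ c G code β)
      fun β hβ => mk_image_le.trans (ih β hβ (hβ.trans hα)))
    intro t ht
    obtain ⟨β, hβ, x, hx, h, -⟩ := (mem_treeLevel_of_cof_eq hcof).1 ht
    exact mem_iUnion.2 ⟨⟨β, hβ⟩, x, hx, h.symm⟩
  · obtain ⟨a, haα, hacof, ha, -⟩ := exists_cofinal_subset α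
    have hW := mk_biUnion_Iio_le hK (mk_Iio_le_of_lt_succ_ord hα)
      (f := treeLevel μ c G code) fun β hβ => ih β hβ (hβ.trans hα)
    set W := ⋃ i : Iio α, treeLevel μ c G code i
    -- The truth value of `i ∈ t` is needed when `a` has a largest element, that is, when `α` is a
    -- successor.
    let F : treeLevel μ c G code α → a → W × ULift.{u + 1} Prop := fun t i =>
      ⟨⟨t.1 ∩ Iio i.1, mem_iUnion.2 ⟨⟨i, haα i.2⟩, inter_Iio_mem_treeLevel t.2 (haα i.2).le⟩⟩,
        ⟨i.1 ∈ t.1⟩⟩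
    have hF : Function.Injective F := by
      rintro ⟨t, ht⟩ ⟨t', ht'⟩ h
      have hpt : ∀ i ∈ a, t ∩ Iio i = t' ∩ Iio i ∧ (i ∈ t ↔ i ∈ t') := fun i hi => by
        have := congrFun h ⟨i, hi⟩
        simp only [F, Prod.mk.injEq, Subtype.mk.injEq, ULift.up.injEq, eq_iff_iff] at this
        exact this
      refine Subtype.ext (ext fun y => ?_)
      by_cases hy : y < α
      · obtain ⟨i, hi, hyi⟩ := hacof y hy
        rcases hyi.eq_or_lt with rfl | hlt
        · exact (hpt _ hi).2
        · have := Set.ext_iff.1 (hpt i hi).1 y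
          simpa [hlt] using this
      · exact iff_of_false (fun h => hy ((isBranch_of_mem_treeLevel ht).1 h))
          fun h => hy ((isBranch_of_mem_treeLevel ht').1 h)
    refine (mk_le_of_injective hF).trans ?_
    rw [← power_def, mk_prod, Cardinal.lift_id, Cardinal.lift_id]
    refine (power_le_power_right ((mul_le_mul' hW ?_).trans (mul_eq_self hK).le)).trans
      (lift_power_le_of_powerlt_eq hlt (ha.trans_lt ?_))
    · rw [mk_uLift, mk_Prop, lift_two]
      exact (natCast_lt_aleph0 (n := 2)).le.trans hK
    · exact Cardinal.lift_lt.2 ((cof_le_of_lt_succ_ord hα).lt_of_ne hcof)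

/-! ### Antichains and chains are bounded -/

/-- Suppose `p ∈ A` lies on a level at or above the `δ` where `A` is hit. Its restriction to `δ` is
sealed at some correctly guessing `ξ < δ`. Either it passes through an element of `A` below `ξ`,
against incomparability, or no node below `ξ` above its initial segment meets `A`. But `p` is such a
node at a higher level, and closure of `ξ` reflects this below `ξ`. -/
theorem exists_bound_antichain {μ : Cardinal.{u}} {c G : Ordinal.{u} → Set Ordinal.{u}}
    {code : Ordinal.{u} → Set Ordinal.{u} → Ordinal.{u}} (hμ : ℵ₀ ≤ μ) (hlt : powerlt μ μ = μ)
    (hc : IsLadderSystem μ c) (hG : IsHittingSystem μ c G) (hcode : IsCoding μ code)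
    {A : Set (Ordinal.{u} × Set Ordinal.{u})}
    (hAT : ∀ p ∈ A, p.1 < (Order.succ μ).ord ∧ p.2 ∈ treeLevel μ c G code p.1)
    (hA : ∀ p ∈ A, ∀ q ∈ A, p.1 ≤ q.1 → q.2 ∩ Iio p.1 = p.2 → p = q) :
    ∃ δ < (Order.succ μ).ord, ∀ p ∈ A, p.1 < δ := by
  set Λ := (Order.succ μ).ord with hΛ
  set T := treeLevel μ c G code
  let E : Ordinal.{u} → Set Ordinal.{u} → Ordinal.{u} → Prop := fun η x ζ =>
    ζ < Λ ∧ η ≤ ζ ∧ ∃ w ∈ T ζ, w ∩ Iio η = x ∧ ∃ p ∈ A, p.1 ≤ ζ ∧ w ∩ Iio p.1 = p.2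
  -- `b₁` bounds the codes of nodes up to level `η`, so that `G ξ` decides membership in `A` for all
  -- nodes below `ξ`. `b₂` bounds the least effort of reaching `A` above a node of level `η`: if `E`
  -- has a witness, it has one at most `b₂ η`.
  have hb₁ : ∀ η, ∃ b, η < Λ → b < Λ ∧ ∀ α ≤ η, ∀ t ∈ T α, code α t ≤ b := fun η => by
    by_cases hη : η < Λ
    · have hη' := succ_lt_succ_ord hμ hη
      have hcard := mk_biUnion_Iio_le (aleph0_le_lift.2 hμ) (mk_Iio_le_of_lt_succ_ord hη')
        (f := fun α => code α '' T α) fun α hα =>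
          mk_image_le.trans (mk_treeLevel_le hμ hlt (hα.trans hη'))
      obtain ⟨b, hb, h⟩ := exists_bound_lt_succ_ord hμ hcard Subtype.val (by
        rintro ⟨_, hx⟩
        obtain ⟨⟨α, hα⟩, t, ht, rfl⟩ := mem_iUnion.1 hx
        exact hcode.1 α (lt_trans hα hη') t (isBranch_of_mem_treeLevel ht).1)
      exact ⟨b, fun _ => ⟨hb, fun α hα t ht =>
        h ⟨_, mem_iUnion.2 ⟨⟨α, Order.lt_succ_iff.2 hα⟩, t, ht, rfl⟩⟩⟩⟩
    · exact ⟨0, fun h => absurd h hη⟩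
  have hb₂ : ∀ η, ∃ b, η < Λ → b < Λ ∧ ∀ x ∈ T η, ∀ ζ, E η x ζ → ∃ ζ' ≤ b, E η x ζ' := fun η => by
    by_cases hη : η < Λ
    · have hz : ∀ x : T η, ∃ ζ' < Λ, ∀ ζ, E η x ζ → E η x ζ' := fun x => by
        by_cases h : ∃ ζ, E η x ζ
        · obtain ⟨ζ, h⟩ := h
          exact ⟨ζ, h.1, fun _ _ => h⟩
        · exact ⟨η, hη, fun ζ hζ => absurd ⟨ζ, hζ⟩ h⟩
      choose z hz1 hz2 using hz
      obtain ⟨b, hb, h⟩ := exists_bound_lt_succ_ord hμ (mk_treeLevel_le hμ hlt hη) z hz1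
      exact ⟨b, fun _ => ⟨hb, fun x hx ζ hζ => ⟨_, h ⟨x, hx⟩, hz2 ⟨x, hx⟩ ζ hζ⟩⟩⟩
    · exact ⟨0, fun h => absurd h hη⟩
  choose b₁ hb₁ using hb₁
  choose b₂ hb₂ using hb₂
  obtain ⟨δ, hδ, hcof, H⟩ := hG {y | ∃ p ∈ A, code p.1 p.2 = y} (fun η => max (b₁ η) (b₂ η))
    fun η hη => max_lt (hb₁ η hη).1 (hb₂ η hη).1
  refine ⟨δ, hδ, fun p hp => ?_⟩
  by_contra! hle
  obtain ⟨hpΛ, hpT⟩ := hAT p hp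
  obtain ⟨-, -, -, -, -, ht, -, i, hi, hseal⟩ := (mem_treeLevel_of_cof_eq hcof).1
    (inter_Iio_mem_treeLevel hpT hle)
  obtain ⟨ξ, hξ, hiξ, hlim, hcl, hag⟩ := H i hi
  have hξδ : ξ < δ := hc.subset δ hδ hcof hξ
  have inA : ∀ q ∈ A, q.1 < ξ → code q.1 q.2 ∈ G ξ := fun q hq hqξ =>
    (hag _ (((hb₁ q.1 (hAT q hq).1).2 _ le_rfl _ (hAT q hq).2).trans_lt
      ((le_max_left _ _).trans_lt (hcl.2 _ hqξ)))).1 ⟨q, hq, rfl⟩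
  obtain ⟨ζ, hζ, h⟩ := hseal ξ hξ hξδ hiξ hlim
  have hζδ := hζ.trans hξδ
  rcases h with ⟨η, hη, h⟩ | h
  · have hηδ := hη.trans_lt hζδ
    rw [inter_Iio_inter_Iio hηδ.le] at h
    have hT := inter_Iio_mem_treeLevel hpT (hηδ.le.trans hle)
    obtain ⟨q, hq, hqe⟩ := (hag _ (((hb₁ η (hηδ.trans hδ)).2 _ le_rfl _ hT).trans_lt
      ((le_max_left _ _).trans_lt (hcl.2 _ (hη.trans_lt hζ))))).2 h
    obtain ⟨h1, h2⟩ := hcode.2 _ (hAT q hq).1 _ (isBranch_of_mem_treeLevel (hAT q hq).2).1 η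
      (hηδ.trans hδ) _ (isBranch_of_mem_treeLevel hT).1 hqe
    have := hA q hq p hp (h1.trans_le (hηδ.le.trans hle)) (by rw [h1, h2])
    subst this
    exact (h1.trans_lt hηδ).not_ge hle
  · rw [inter_Iio_inter_Iio hζδ.le] at h
    obtain ⟨ζ', hζ', -, hζζ', w, hw, hwx, q, hq, hqζ, hwq⟩ :=
      (hb₂ ζ (hζδ.trans hδ)).2 _ (inter_Iio_mem_treeLevel hpT (hζδ.le.trans hle)) p.1
        ⟨hpΛ, hζδ.le.trans hle, p.2, hpT, rfl, p, hp, le_rfl,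
          inter_eq_left.2 (isBranch_of_mem_treeLevel hpT).1⟩
    have hζξ : ζ' < ξ := hζ'.trans_lt ((le_max_right _ _).trans_lt (hcl.2 _ hζ))
    refine h ζ' hζξ hζζ' w hw hwx q.1 hqζ ?_
    rw [hwq]
    exact inA q hq (hqζ.trans_lt hζξ)

theorem exists_bound_chain {μ : Cardinal.{u}} {c G : Ordinal.{u} → Set Ordinal.{u}}
    {code : Ordinal.{u} → Set Ordinal.{u} → Ordinal.{u}} (hμ : ℵ₀ ≤ μ) (hlt : powerlt μ μ = μ)
    (hc : IsLadderSystem μ c) (hG : IsHittingSystem μ c G) (hcode : IsCoding μ code)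
    {C : Set (Ordinal.{u} × Set Ordinal.{u})}
    (hCT : ∀ p ∈ C, p.1 < (Order.succ μ).ord ∧ p.2 ∈ treeLevel μ c G code p.1)
    (hC : ∀ p ∈ C, ∀ q ∈ C, p.1 ≤ q.1 → q.2 ∩ Iio p.1 = p.2) :
    ∃ δ < (Order.succ μ).ord, ∀ p ∈ C, p.1 < δ := by
  by_contra! hunb
  let b : Set Ordinal.{u} := ⋃ p ∈ C, p.2
  have hb : ∀ p ∈ C, b ∩ Iio p.1 = p.2 := fun p hp => by
    ext y
    constructor
    · rintro ⟨hy, hyp⟩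
      obtain ⟨q, hq, hyq⟩ := mem_iUnion₂.1 hy
      rcases le_total p.1 q.1 with h | h
      · rw [← hC p hp q hq h]
        exact ⟨hyq, hyp⟩
      · rw [← hC q hq p hp h] at hyq
        exact hyq.1
    · exact fun hy => ⟨mem_iUnion₂.2 ⟨p, hp, hy⟩, (isBranch_of_mem_treeLevel (hCT p hp).2).1 hy⟩
  have hbT : ∀ γ < (Order.succ μ).ord, b ∩ Iio γ ∈ treeLevel μ c G code γ := fun γ hγ => by
    obtain ⟨p, hp, hle⟩ := hunb γ hγ
    have := inter_Iio_mem_treeLevel (hCT p hp).2 hle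
    rwa [← hb p hp, inter_Iio_inter_Iio hle] at this
  -- `s γ` follows the long branch `b` below `γ` and departs from it exactly at `γ`. It is a node of
  -- level `γ + 1`, since a successor level contains every branch, and these nodes form an unbounded
  -- antichain.
  let s : Ordinal.{u} → Set Ordinal.{u} := fun γ => {x | x ≤ γ ∧ (x ∈ b ↔ x ≠ γ)}
  have hs : ∀ γ, ∀ η ≤ γ, s γ ∩ Iio η = b ∩ Iio η := fun γ η hη => by
    ext x
    refine and_congr_left fun hx => ?_
    have hxγ : x < γ := lt_of_lt_of_le hx hη
    simp [s, hxγ.le, hxγ.ne]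
  obtain ⟨δ, hδ, h⟩ := exists_bound_antichain hμ hlt hc hG hcode
    (A := {p | ∃ γ < (Order.succ μ).ord, p = (Order.succ γ, s γ)}) (by
      rintro _ ⟨γ, hγ, rfl⟩
      refine ⟨succ_lt_succ_ord hμ hγ, (mem_treeLevel_of_cof_ne ?_).2
        ⟨fun x hx => Order.lt_succ_iff.2 hx.1, fun η hη => ?_⟩⟩
      · rw [Order.succ_eq_add_one, cof_add_one]
        exact (one_lt_aleph0.trans_le hμ).ne
      · rw [hs γ η (Order.lt_succ_iff.1 hη)]
        exact hbT η ((Order.lt_succ_iff.1 hη).trans_lt hγ)) (by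
      rintro _ ⟨γ, hγ, rfl⟩ _ ⟨γ', hγ', rfl⟩ hle heq
      rcases (Order.succ_le_succ_iff.1 hle).eq_or_lt with rfl | hlt
      · rfl
      · exfalso
        dsimp only at heq
        rw [hs γ' _ (Order.succ_le_of_lt hlt)] at heq
        have := Set.ext_iff.1 heq γ
        simp [s] at this)
  exact (h _ ⟨δ, hδ, rfl⟩).not_ge (Order.le_succ δ)

/-! ### The tree as a partial order -/

/-- The nodes of a tree of height `Λ` with levels `L`. -/
@[ext]
structure TreeNode (Λ : Ordinal.{u}) (L : Ordinal.{u} → Set (Set Ordinal.{u})) where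
  /-- The level of the node, and the node as a set of ordinals. -/
  val : Ordinal.{u} × Set Ordinal.{u}
  property : val.1 < Λ ∧ val.2 ∈ L val.1 ∧ val.2 ⊆ Iio val.1

/-- The nodes are ordered by end-extension. -/
instance (Λ : Ordinal.{u}) (L : Ordinal.{u} → Set (Set Ordinal.{u})) :
    PartialOrder (TreeNode Λ L) where
  le p q := p.1.1 ≤ q.1.1 ∧ q.1.2 ∩ Iio p.1.1 = p.1.2
  le_refl p := ⟨le_rfl, inter_eq_left.2 p.2.2.2⟩
  le_trans p q r hpq hqr := ⟨hpq.1.trans hqr.1, by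
    rw [← hpq.2, ← hqr.2, inter_Iio_inter_Iio hpq.1]⟩
  le_antisymm p q hpq hqp := TreeNode.ext (Prod.ext (hpq.1.antisymm hqp.1) (by
    rw [← hpq.2, hpq.1.antisymm hqp.1, inter_eq_left.2 q.2.2.2]))

namespace TreeNode

variable {Λ : Ordinal.{u}} {L : Ordinal.{u} → Set (Set Ordinal.{u})} {p q : TreeNode Λ L}

theorem eq_of_le_of_le (h : p ≤ q) (h' : q.1.1 ≤ p.1.1) : p = q :=
  h.antisymm ⟨h', by rw [← h.2, ← h.1.antisymm h', inter_Iio_inter_Iio le_rfl,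
    h.1.antisymm h', inter_eq_left.2 q.2.2.2]⟩

theorem lt_iff : p < q ↔ p ≤ q ∧ p.1.1 < q.1.1 := by
  refine ⟨fun h => ⟨h.le, h.le.1.lt_of_ne fun heq => h.ne (eq_of_le_of_le h.le heq.ge)⟩,
    fun h => h.1.lt_of_ne ?_⟩
  rintro rfl
  exact h.2.false

theorem le_total_of_le {x : TreeNode Λ L} (hp : p ≤ x) (hq : q ≤ x) (h : p.1.1 ≤ q.1.1) :
    p ≤ q :=
  ⟨h, by rw [← hq.2, ← hp.2, inter_Iio_inter_Iio h]⟩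

/-- The initial segments of a node are indexed by the ordinals below its level. -/
noncomputable def relIsoIio (hL : ∀ α, ∀ t ∈ L α, ∀ β ≤ α, t ∩ Iio β ∈ L β) (x : TreeNode Λ L) :
    ((· < ·) : Iio x → Iio x → Prop) ≃r ((· < ·) : Iio x.1.1 → Iio x.1.1 → Prop) where
  toFun p := ⟨p.1.1.1, (lt_iff.1 p.2).2⟩
  invFun β := ⟨⟨(β, x.1.2 ∩ Iio β.1), lt_trans β.2 x.2.1, hL _ _ x.2.2.1 _ (le_of_lt β.2),
    inter_subset_right⟩, lt_iff.2 ⟨⟨le_of_lt β.2, rfl⟩, β.2⟩⟩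
  left_inv p := Subtype.ext (TreeNode.ext (Prod.ext rfl (lt_iff.1 p.2).1.2))
  right_inv β := rfl
  map_rel_iff' {p q} := by
    refine ⟨fun h => lt_iff.2 ⟨le_total_of_le (lt_iff.1 p.2).1 (lt_iff.1 q.2).1 (le_of_lt h), h⟩,
      fun h => (lt_iff.1 h).2⟩

end TreeNode

section

variable {T : Type u} [PartialOrder T] {Λ : Ordinal.{u}} {L : Ordinal.{u} → Set (Set Ordinal.{u})}

/-- The predecessors in a tree isomorphic to a tree of nodes. -/
noncomputable def OrderIso.relIsoIio (e : T ≃o TreeNode Λ L)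
    (hL : ∀ α, ∀ t ∈ L α, ∀ β ≤ α, t ∩ Iio β ∈ L β) (x : T) :
    ((· < ·) : Iio x → Iio x → Prop) ≃r
      ((· < ·) : Iio (e x).1.1 → Iio (e x).1.1 → Prop) :=
  RelIso.trans ⟨e.toEquiv.subtypeEquiv fun _ => e.lt_iff_lt.symm, e.lt_iff_lt⟩
    (TreeNode.relIsoIio hL (e x))

theorem OrderIso.isOrderTree (e : T ≃o TreeNode Λ L)
    (hL : ∀ α, ∀ t ∈ L α, ∀ β ≤ α, t ∩ Iio β ∈ L β) : IsOrderTree T :=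
  ⟨fun x => (e.relIsoIio hL x).toRelEmbedding.isWellOrder⟩

theorem OrderIso.level_eq [IsOrderTree T] (e : T ≃o TreeNode Λ L)
    (hL : ∀ α, ∀ t ∈ L α, ∀ β ≤ α, t ∩ Iio β ∈ L β) (x : T) :
    IsOrderTree.level x = (e x).1.1 := by
  have h := (e.relIsoIio hL x).ordinal_lift_type_eq
  rwa [type_lt_Iio, Ordinal.lift_lift, Ordinal.lift_inj] at h

theorem OrderIso.height_eq [IsOrderTree T] (e : T ≃o TreeNode Λ L)
    (hL : ∀ α, ∀ t ∈ L α, ∀ β ≤ α, t ∩ Iio β ∈ L β) (hne : ∀ α < Λ, ∃ t ∈ L α, t ⊆ Iio α) :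
    IsOrderTree.height T = Λ := by
  refine le_antisymm (Ordinal.iSup_le fun x => ?_) (le_of_forall_lt fun α hα => ?_)
  · rw [e.level_eq hL]
    exact Order.succ_le_of_lt (e x).2.1
  · obtain ⟨t, ht, hsub⟩ := hne α hα
    have h := Ordinal.le_iSup (fun x : T => Order.succ (IsOrderTree.level x))
      (e.symm ⟨(α, t), hα, ht, hsub⟩)
    rw [e.level_eq hL, e.apply_symm_apply] at h
    exact (Order.lt_succ α).trans_le h

end

theorem mk_lt_of_bounded {μ : Cardinal.{u}} (hμ : ℵ₀ ≤ μ) {T : Type u} [PartialOrder T]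
    {L : Ordinal.{u} → Set (Set Ordinal.{u})} (e : T ≃o TreeNode (Order.succ μ).ord L)
    (hL : ∀ α < (Order.succ μ).ord, #(L α) ≤ lift.{u + 1} μ) {A : Set T} {δ : Ordinal.{u}}
    (hδ : δ < (Order.succ μ).ord) (hA : ∀ x ∈ A, (e x).1.1 < δ) : #A < Order.succ μ := by
  rw [Order.lt_succ_iff, ← Cardinal.lift_le.{u + 1}]
  have h := mk_biUnion_Iio_le (aleph0_le_lift.2 hμ) (mk_Iio_le_of_lt_succ_ord hδ)
    (f := fun α => Prod.mk α '' L α) fun α hα => mk_image_le.trans (hL α (hα.trans hδ))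
  refine le_trans ?_ h
  refine mk_le_of_injective (f := fun x : ULift A => ⟨(e x.down.1).1, mem_iUnion.2
    ⟨⟨_, hA x.down.1 x.down.2⟩, _, (e x.down.1).2.2.1, rfl⟩⟩) fun x y hxy => ?_
  exact ULift.ext _ _ (Subtype.ext (e.injective (TreeNode.ext (Subtype.ext_iff.1 hxy))))

/-- If the supremum `ρ` of the levels is attained, that term is the bound. Otherwise `cof ρ ≤ |β| <
μ`, so level `ρ` contains the union of the sequence. -/
theorem treeNode_isCompleteTree {μ : Cardinal.{u}} (hμ : ℵ₀ ≤ μ)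
    {L : Ordinal.{u} → Set (Set Ordinal.{u})}
    (hL : ∀ α, ∀ t ∈ L α, ∀ β ≤ α, t ∩ Iio β ∈ L β)
    (hfull : ∀ α < (Order.succ μ).ord, α.cof ≠ μ → ∀ t, IsBranch L α t → t ∈ L α)
    (hne : Nonempty (TreeNode (Order.succ μ).ord L)) {β : Ordinal.{u}} (hβ : β < μ.ord)
    {s : Iio β → TreeNode (Order.succ μ).ord L} (hs : StrictMono s) : ∃ b, ∀ i, s i ≤ b := by
  have hcard : #(Iio β) < lift.{u + 1} μ := by
    rw [Cardinal.mk_Iio_ordinal, Cardinal.lift_lt]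
    exact lt_ord.1 hβ
  obtain ⟨B, hB, hsB⟩ := exists_bound_lt_succ_ord hμ hcard.le (fun i => (s i).1.1) fun i => (s i).2.1
  rcases isEmpty_or_nonempty (Iio β) with hem | _
  · exact ⟨hne.some, fun i => hem.elim i⟩
  have hbdd : BddAbove (range fun i => (s i).1.1) := ⟨B, by rintro _ ⟨i, rfl⟩; exact hsB i⟩
  set ρ := sSup (range fun i => (s i).1.1) with hρ
  have hle : ∀ i, (s i).1.1 ≤ ρ := fun i => le_csSup hbdd ⟨i, rfl⟩
  have hρΛ : ρ < (Order.succ μ).ord :=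
    (csSup_le (range_nonempty _) (by rintro _ ⟨i, rfl⟩; exact hsB i)).trans_lt hB
  by_cases hatt : ∃ i, (s i).1.1 = ρ
  · obtain ⟨i, hi⟩ := hatt
    refine ⟨s i, fun j => ?_⟩
    rcases le_or_gt j i with h | h
    · exact hs.monotone h
    · exact absurd (hle j) (hi ▸ (TreeNode.lt_iff.1 (hs h)).2).not_ge
  · push Not at hatt
    have hlt : ∀ i, (s i).1.1 < ρ := fun i => (hle i).lt_of_ne (hatt i)
    have hex : ∀ η < ρ, ∃ i, η < (s i).1.1 := fun η hη => by
      obtain ⟨_, ⟨i, rfl⟩, h⟩ := exists_lt_of_lt_csSup (range_nonempty _) hη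
      exact ⟨i, h⟩
    have hcof : ρ.cof ≠ μ := fun h => by
      obtain ⟨η, hη, h'⟩ := exists_bound_of_mk_lt_cof (X := range fun i => (s i).1.1) (δ := ρ)
        (by rw [h]; exact mk_range_le.trans_lt hcard) (by rintro _ ⟨i, rfl⟩; exact hlt i)
      obtain ⟨i, hi⟩ := hex η hη
      exact (h' _ ⟨i, rfl⟩).not_gt hi
    let t : Set Ordinal.{u} := ⋃ i, (s i).1.2
    have ht : ∀ i, t ∩ Iio (s i).1.1 = (s i).1.2 := fun i => by
      ext y
      constructor
      · rintro ⟨hy, hyi⟩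
        obtain ⟨j, hyj⟩ := mem_iUnion.1 hy
        rcases le_total i j with h | h
        · rw [← (hs.monotone h).2]
          exact ⟨hyj, hyi⟩
        · rw [← (hs.monotone h).2] at hyj
          exact hyj.1
      · exact fun hy => ⟨mem_iUnion.2 ⟨i, hy⟩, (s i).2.2.2 hy⟩
    have htsub : t ⊆ Iio ρ := iUnion_subset fun i => (s i).2.2.2.trans (Iio_subset_Iio (hle i))
    refine ⟨⟨(ρ, t), hρΛ, hfull ρ hρΛ hcof t ⟨htsub, fun η hη => ?_⟩, htsub⟩,
      fun i => ⟨hle i, ht i⟩⟩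
    obtain ⟨i, hi⟩ := hex η hη
    rw [← inter_Iio_inter_Iio hi.le, ht i]
    exact hL _ _ (s i).2.2.1 _ hi.le

theorem mk_treeNode {μ : Cardinal.{u}} (hμ : ℵ₀ ≤ μ) {L : Ordinal.{u} → Set (Set Ordinal.{u})}
    (hL : ∀ α < (Order.succ μ).ord, #(L α) ≤ lift.{u + 1} μ)
    (hne : ∀ α < (Order.succ μ).ord, ∃ t ∈ L α, t ⊆ Iio α) :
    #(TreeNode (Order.succ μ).ord L) = lift.{u + 1} (Order.succ μ) := by
  have hΛ : #(Iio (Order.succ μ).ord) = lift.{u + 1} (Order.succ μ) := by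
    rw [Cardinal.mk_Iio_ordinal, card_ord]
  refine le_antisymm ?_ ?_
  · have h := mk_biUnion_Iio_le (aleph0_le_lift.2 (hμ.trans (Order.le_succ μ))) hΛ.le
      (f := fun α => Prod.mk α '' L α) fun α hα => mk_image_le.trans
        ((hL α hα).trans (Cardinal.lift_le.2 (Order.le_succ μ)))
    refine le_trans ?_ h
    exact mk_le_of_injective (f := fun p : TreeNode (Order.succ μ).ord L =>
      ⟨p.1, mem_iUnion.2 ⟨⟨_, p.2.1⟩, _, p.2.2.1, rfl⟩⟩)
      fun x y hxy => TreeNode.ext (Subtype.ext_iff.1 hxy)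
  · rw [← hΛ]
    choose t ht hsub using hne
    exact mk_le_of_injective (f := fun α : Iio (Order.succ μ).ord =>
      (⟨(α.1, t α.1 α.2), α.2, ht _ _, hsub _ _⟩ : TreeNode (Order.succ μ).ord L))
      fun α β h => Subtype.ext (congrArg (fun p => p.1.1) h)

/-! ### The Souslin tree -/

theorem corollary5 (μ : Cardinal.{u}) (hμ : Cardinal.aleph0 ≤ μ)
    (h2 : (2 : Cardinal.{u}) ^ μ = Order.succ μ)
    (hlt : Cardinal.powerlt μ μ = μ)
    (hS : ∃ S : Set Ordinal.{u},
      S ⊆ {α | α < (Order.succ μ).ord ∧ α.cof < μ} ∧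
      StationaryIn S (Order.succ μ).ord ∧
      NonReflectingIn S (Order.succ μ).ord) :
    ∃ (T : Type u) (_ : PartialOrder T), IsSouslinTree (Order.succ μ) T ∧ IsCompleteTree μ T := by
  obtain ⟨S, hSsub, hSst, hNR⟩ := hS
  -- For `μ = ℵ₀` the set `S` would contain no limit ordinals, but a stationary set contains an
  -- ordinal closed under successor.
  have hμ' : ℵ₀ < μ := by
    refine hμ.lt_of_ne ?_
    rintro rfl
    obtain ⟨ξ, hξS, -, hξ⟩ := hSst.exists_closedUnder le_rfl (φ := Order.succ)
      fun η hη => succ_lt_succ_ord le_rfl hη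
    have hlim : IsLimitPoint univ ξ :=
      ⟨hξ.1, fun η hη => ⟨_, mem_univ _, Order.lt_succ η, hξ.2 η hη⟩⟩
    exact (aleph0_le_cof_iff.2 (one_lt_cof_iff.2 hlim.isSuccLimit)).not_gt (hSsub hξS).2
  obtain ⟨c, G, hc, hG⟩ := exists_isHittingSystem hμ' h2 hlt (fun α hα => (hSsub hα).2) hSst hNR
  obtain ⟨code, hcode⟩ := exists_isCoding hμ h2
  set L := treeLevel μ c G code with hLdef
  have hL : ∀ α, ∀ t ∈ L α, ∀ β ≤ α, t ∩ Iio β ∈ L β := fun α t ht β hβ =>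
    inter_Iio_mem_treeLevel ht hβ
  have hcard : ∀ α < (Order.succ μ).ord, #(L α) ≤ lift.{u + 1} μ := fun α hα =>
    mk_treeLevel_le hμ hlt hα
  have hne : ∀ α < (Order.succ μ).ord, ∃ t ∈ L α, t ⊆ Iio α := fun α hα => by
    have h0 : (∅ : Set Ordinal.{u}) ∈ L 0 := (mem_treeLevel_of_cof_ne (by
      rw [cof_zero]; exact (aleph0_pos.trans_le hμ).ne)).2
      ⟨empty_subset _, fun β hβ => absurd hβ not_lt_zero⟩
    obtain ⟨t, ht, -⟩ := exists_treeLevel_extension hc hα zero_le h0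
    exact ⟨t, ht, (isBranch_of_mem_treeLevel ht).1⟩
  have hmk := mk_treeNode hμ hcard hne
  -- Nodes are made of ordinals and so live in universe `u + 1`; having only `μ⁺` of them allows the
  -- tree to be moved to `Type u`.
  have hsmall : Small.{u} (TreeNode (Order.succ μ).ord L) := by
    rw [Cardinal.small_iff_lift_mk_lt_univ, hmk, Cardinal.lift_id]
    exact lift_lt_univ _
  let T := Shrink.{u} (TreeNode (Order.succ μ).ord L)
  let e₀ : T ≃ TreeNode (Order.succ μ).ord L := (equivShrink _).symm
  let _ : PartialOrder T := PartialOrder.lift e₀ e₀.injective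
  let e : T ≃o TreeNode (Order.succ μ).ord L := ⟨e₀, Iff.rfl⟩
  have htree := e.isOrderTree hL
  have himage : ∀ A : Set T, ∀ p ∈ (fun x => (e x).1) '' A,
      p.1 < (Order.succ μ).ord ∧ p.2 ∈ L p.1 := by
    rintro A _ ⟨x, -, rfl⟩
    exact ⟨(e x).2.1, (e x).2.2.1⟩
  refine ⟨T, inferInstance, ⟨htree, ?_, e.height_eq hL hne, fun C hC => ?_, fun A hA => ?_⟩,
    fun β hβ s hs => ?_⟩
  · rw [← Cardinal.lift_inj.{u, u + 1}, ← hmk]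
    exact (Cardinal.mk_congr (Equiv.ulift.trans e₀))
  · obtain ⟨δ, hδ, h⟩ := exists_bound_chain hμ hlt hc hG hcode (himage C) (by
      rintro _ ⟨x, hx, rfl⟩ _ ⟨y, hy, rfl⟩ hle
      rcases hC.total hx hy with h | h
      · exact (e.le_iff_le.2 h).2
      · dsimp only
        rw [← TreeNode.eq_of_le_of_le (e.le_iff_le.2 h) hle, inter_eq_left.2 (e y).2.2.2])
    exact mk_lt_of_bounded hμ e hcard hδ fun x hx => h _ ⟨x, hx, rfl⟩
  · obtain ⟨δ, hδ, h⟩ := exists_bound_antichain hμ hlt hc hG hcode (himage A) (by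
      rintro _ ⟨x, hx, rfl⟩ _ ⟨y, hy, rfl⟩ hle heq
      rw [hA.eq hx hy (e.le_iff_le.1 ⟨hle, heq⟩)])
    exact mk_lt_of_bounded hμ e hcard hδ fun x hx => h _ ⟨x, hx, rfl⟩
  · obtain ⟨t, ht, hsub⟩ := hne 0 (ord_pos.2 (succ_pos μ))
    obtain ⟨b, hb⟩ := treeNode_isCompleteTree hμ hL
      (fun α _ hcof t ht => (mem_treeLevel_of_cof_ne hcof).2 ht)
      ⟨⟨(0, t), ord_pos.2 (succ_pos μ), ht, hsub⟩⟩ hβ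
      (s := fun i => e (s i)) (e.strictMono.comp hs)
    exact ⟨e.symm b, fun i => e.le_symm_apply.2 (hb i)⟩
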